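/- Let $m,p$ be integers with $p>m\ge 1$ and let $M>0$. For knots $0=x_0<x_1<\dots<x_K<x_{K+1}=1$ let $S_K^p=S_K^p([0,1])$ be the space of splines of order $p$, i.e. of all $s\in\mathcal C^{p-2}([0,1])$ that agree with a polynomial of degree at most $p-1$ on each $[x_i,x_{i+1}]$, $0\le i\le K$. For $\lambda\ge 0$ put $$\langle f,g\rangle_{m,\lambda}=\int_0^1 fg\,dt+\lambda\int_0^1 f^{(m)}g^{(m)}\,dt,\qquad \|f\|_{m,\lambda}=\langle f,f\rangle_{m,\lambda}^{1/2}.$$ There is a constant $c_0>0$, depending only on $m$, $p$ and $M$, such that the following holds for every sequence of knot vectors $0=x_{n,0}<\dots<x_{n,K_n+1}=1$, $n\in\mathbb N$, satisfying, with $h_{n,i}=x_{n,i}-x_{n,i-1}$, * (B6) $K_n\to\infty$, and $n^{\delta'-1}K_n^2\to0$ for some $\delta'>0$; * (B7) $\max_{1\le i\le K_n}|h_{n,i+1}-h_{n,i}|=o(K_n^{-1})$, and $\max_i h_{n,i}/\min_i h_{n,i}\le M$ for every $n$. For every $n$ with $K=K_n\ge1$ and every $\lambda\in[0,1]$ (with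 $S_K^p$ formed from the $n$-th knot vector): 1. for every $f\in S_K^p$, $$\sup_{t\in[0,1]}|f(t)|\le c_0\min\{K^{1/2},\lambda^{-1/(4m)}\}\,\|f\|_{m,\lambda},$$ where $\lambda^{-1/(4m)}=\infty$ for $\lambda=0$; 2. let $\mathbf B=(B_1,\dots,B_{K+p})^\top$ be the B-splines of order $p$ (given by the Cox-de Boor recursion for the knot sequence in which $0$ and $1$ are repeated $p$ times and each interior knot occurs once), and let $\mathbf G_\lambda=\mathbf H_p+\lambda\mathbf P_m$ with $\mathbf H_p=(\int_0^1 B_iB_j\,dt)_{i,j}$ and $\mathbf P_m=(\int_0^1 B_i^{(m)}B_j^{(m)}\,dt)_{i,j}$. Then $\mathbf G_\lambda$ is invertible, and $\mathcal R(x,y)=\mathbf B(x)^\top\mathbf G_\lambda^{-1}\mathbf B(y)$ is symmetric, satisfies $\mathcal R(\cdot,y)\in S_K^p$ for every $y\in[0,1]$, and $f(t)=\langle\mathcal R(t,\cdot),f\rangle_{m,\lambda}$ for all $f\in S_K^p$ and $t\in[0,1]$. Thus $S_K^p$ with $\langle\cdot,\cdot\rangle_{m,\lambda}$ is a reproducing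 kernel Hilbert space with kernel $\mathcal R$. -/

import Mathlib

open Filter Topology Asymptotics
open scoped Matrix unitInterval

namespace PenalizedSpline

noncomputable section

/-- The points `0 = x 0 < x 1 < ⋯ < x K < x (K+1) = 1`: the `K` interior knots together with the
two endpoints of `[0,1]`. -/
structure IsKnotVector {K : ℕ} (x : Fin (K + 2) → ℝ) : Prop where
  strictMono : StrictMono x
  left : x 0 = 0
  right : x (Fin.last (K + 1)) = 1

/-- The knot spacing `x (i+1) - x i`, for `i = 0, …, K`. -/
def spacing {K : ℕ} (x : Fin (K + 2) → ℝ) (i : Fin (K + 1)) : ℝ :=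
  x i.succ - x i.castSucc

/-- Growth of the number of interior knots: `K_n → ∞`, and `n ^ (δ - 1) * K_n ^ 2 → 0` for some
`δ > 0`. -/
def KnotGrowth (K : ℕ → ℕ) : Prop :=
  Tendsto K atTop atTop ∧
    ∃ δ : ℝ, 0 < δ ∧ Tendsto (fun n : ℕ => (n : ℝ) ^ (δ - 1) * (K n : ℝ) ^ 2) atTop (𝓝 0)

/-- Quasi-uniformity of the knots with mesh ratio bound `M`: consecutive spacings differ by at most
`o(1 / K_n)`, and `(largest spacing) / (smallest spacing) ≤ M` for every `n`. -/
def QuasiUniformKnots (K : ℕ → ℕ) (x : ∀ n, Fin (K n + 2) → ℝ) (M : ℝ) : Prop :=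
  ((fun n => ⨆ i : Fin (K n), |spacing (x n) i.succ - spacing (x n) i.castSucc|)
      =o[atTop] fun n => ((K n : ℝ))⁻¹) ∧
    ∀ n, (⨆ i, spacing (x n) i) / (⨅ i, spacing (x n) i) ≤ M

/-- A function on `[0,1]` as a function on `ℝ`, constant to the left of `0` and to the right of `1`.
It is only ever examined inside `[0,1]`. -/
def extend (f : I → ℝ) : ℝ → ℝ :=
  Set.IccExtend (zero_le_one' ℝ) f

/-- The `k`-th derivative of `f : [0,1] → ℝ` (one-sided at the endpoints). If the `(k-1)`-st
derivative fails to be differentiable at finitely many points, the value there is `0`, which is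
irrelevant for integrals. -/
def der (k : ℕ) (f : I → ℝ) : ℝ → ℝ :=
  iteratedDerivWithin k (extend f) (Set.Icc 0 1)

/-- The inner product of `L²([0,1])`. -/
def l2Inner (u v : ℝ → ℝ) : ℝ :=
  ∫ t in (0 : ℝ)..1, u t * v t

/-- `⟨f, g⟩_{m,lam} = ⟨f, g⟩ + lam * ⟨f^(m), g^(m)⟩`. -/
def penInner (m : ℕ) (lam : ℝ) (f g : I → ℝ) : ℝ :=
  l2Inner (extend f) (extend g) + lam * l2Inner (der m f) (der m g)

/-- `‖f‖_{m,lam} = ⟨f, f⟩_{m,lam} ^ (1/2)`. -/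
def penNorm (m : ℕ) (lam : ℝ) (f : I → ℝ) : ℝ :=
  √(penInner m lam f f)

/-- The splines of order `p ≥ 2` on `[0,1]` with knots `x`: functions of class `C^(p-2)` on `[0,1]`
that coincide with a polynomial of degree at most `p - 1` on each `[x i, x (i+1)]`. -/
def splineSpace (p : ℕ) {K : ℕ} (x : Fin (K + 2) → ℝ) : Submodule ℝ (I → ℝ) where
  carrier := {f | ContDiffOn ℝ ((p - 2 : ℕ) : WithTop ℕ∞) (extend f) (Set.Icc 0 1) ∧
    ∀ i : Fin (K + 1), ∃ P : Polynomial ℝ, P.degree < (p : WithBot ℕ) ∧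
      ∀ t : I, (t : ℝ) ∈ Set.Icc (x i.castSucc) (x i.succ) → f t = P.eval (t : ℝ)}
  zero_mem' := ⟨contDiffOn_const (c := (0 : ℝ)), fun _ =>
    ⟨0, by rw [Polynomial.degree_zero]; exact WithBot.bot_lt_coe p, by simp⟩⟩
  add_mem' := by
    rintro f g ⟨hf, hf'⟩ ⟨hg, hg'⟩
    refine ⟨hf.add hg, fun i => ?_⟩
    obtain ⟨P, hP, hfP⟩ := hf' i
    obtain ⟨Q, hQ, hgQ⟩ := hg' i
    refine ⟨P + Q, (Polynomial.degree_add_le P Q).trans_lt (max_lt hP hQ), fun t ht => ?_⟩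
    simp [hfP t ht, hgQ t ht]
  smul_mem' := by
    rintro c f ⟨hf, hf'⟩
    refine ⟨contDiffOn_const.mul hf, fun i => ?_⟩
    obtain ⟨P, hP, hfP⟩ := hf' i
    refine ⟨c • P, (Polynomial.degree_smul_le c P).trans_lt hP, fun t ht => ?_⟩
    simp [hfP t ht]

/-- The extended knot sequence of order `p`: `0` repeated `p` times (indices `0, …, p-1`), the
interior knots (index `p-1+i` carries `x i`), then `1` repeated `p` times
(indices `p+K, …, 2p+K-1`). The subtraction is meant to be truncated. -/
def extKnot (p : ℕ) {K : ℕ} (x : Fin (K + 2) → ℝ) (j : ℕ) : ℝ :=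
  x ⟨min (j - (p - 1)) (K + 1), by omega⟩

/-- The Cox-de Boor recursion on `[0,1]` for a nondecreasing knot sequence `t`:
`deBoor t q j` is the `j`-th B-spline of order `q + 1`. The order-one B-splines are the indicators
of `[t j, t (j+1))`, where the nonempty interval ending in `1` also includes its right endpoint.
Quotients with denominator zero count as zero, as is usual. -/
def deBoor (t : ℕ → ℝ) : ℕ → ℕ → ℝ → ℝ
  | 0, j, s =>
      open Classical in
      if t j ≤ s ∧ (s < t (j + 1) ∨ (s = 1 ∧ t j < 1 ∧ t (j + 1) = 1)) then 1 else 0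
  | q + 1, j, s =>
      (s - t j) / (t (j + q + 1) - t j) * deBoor t q j s +
        (t (j + q + 2) - s) / (t (j + q + 2) - t (j + 1)) * deBoor t q (j + 1) s

/-- The B-splines of order `p` with interior knots `x 1, …, x K`, as functions on `[0,1]`. -/
def bspline (p : ℕ) {K : ℕ} (x : Fin (K + 2) → ℝ) (j : Fin (K + p)) : I → ℝ :=
  fun s => deBoor (extKnot p x) (p - 1) j s

/-- The Gram matrix with entries `⟨B_i, B_j⟩`. -/
def gramMatrix (p : ℕ) {K : ℕ} (x : Fin (K + 2) → ℝ) : Matrix (Fin (K + p)) (Fin (K + p)) ℝ :=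
  Matrix.of fun i j => l2Inner (extend (bspline p x i)) (extend (bspline p x j))

/-- The penalty matrix with entries `⟨B_i^(m), B_j^(m)⟩`. -/
def penaltyMatrix (m p : ℕ) {K : ℕ} (x : Fin (K + 2) → ℝ) :
    Matrix (Fin (K + p)) (Fin (K + p)) ℝ :=
  Matrix.of fun i j => l2Inner (der m (bspline p x i)) (der m (bspline p x j))

/-- `G_lam = H_p + lam * P_m`. -/
def penGram (m p : ℕ) (lam : ℝ) {K : ℕ} (x : Fin (K + 2) → ℝ) :
    Matrix (Fin (K + p)) (Fin (K + p)) ℝ :=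
  gramMatrix p x + lam • penaltyMatrix m p x

/-- The function `(s, t) ↦ B(s)ᵀ G_lam⁻¹ B(t)`. -/
def splineKernel (m p : ℕ) (lam : ℝ) {K : ℕ} (x : Fin (K + 2) → ℝ) (s t : I) : ℝ :=
  (fun i => bspline p x i s) ⬝ᵥ ((penGram m p lam x)⁻¹ *ᵥ fun j => bspline p x j t)

/-- `min {K^(1/2), lam^(-1/(4m))}`, where `lam^(-1/(4m))` is `∞` for `lam = 0`. -/
def supRate (m K : ℕ) (lam : ℝ) : ℝ :=
  if lam = 0 then (K : ℝ) ^ (1 / 2 : ℝ)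
  else min ((K : ℝ) ^ (1 / 2 : ℝ)) (lam ^ (-(1 / (4 * (m : ℝ)))))

/-- The space `S` of real functions on `X`, with the form `ip` as inner product, is a reproducing
kernel Hilbert space with kernel `k`: there is a (complete) reproducing kernel Hilbert space whose
elements are, as functions, exactly those of `S`, whose inner product is `ip`, and whose kernel
is `k`. -/
def IsRKHSWithKernel {X : Type} (S : Submodule ℝ (X → ℝ)) (ip : (X → ℝ) → (X → ℝ) → ℝ)
    (k : X → X → ℝ) : Prop :=
  ∃ (H : Type) (_ : NormedAddCommGroup H) (_ : InnerProductSpace ℝ H) (_ : CompleteSpace H)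
    (_ : RKHS ℝ H X ℝ),
    Set.range (fun (f : H) (y : X) => f y) = (S : Set (X → ℝ)) ∧
    (∀ f g : H, inner ℝ f g = ip (fun y => f y) (fun y => g y)) ∧
    ∀ y z : X, RKHS.kernel H y z 1 = k y z

end

end PenalizedSpline

open PenalizedSpline

/-! The sup bound combines two local estimates. Between neighbouring knots at distance `h` a spline
is a polynomial of bounded degree, so rescaling and norm equivalence give `f(t)² ≤ C h⁻¹ ∫ f²`; the
mesh ratio makes `h⁻¹` at most `M (K + 1)`, hence the rate `K^(1/2)` (`exists_sq_le_of_spacing`). On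
any interval of length `h` in `[0,1]`, whatever the knots, Taylor approximation turns the same
polynomial estimate into `f(t)² ≤ C h⁻¹ (∫ f² + h^(2m) ∫ (f^(m))²)` (`exists_sobolev_const`,
`exists_sq_le_of_penalty`). Choosing `h = lam^(1/(2m))` gives the rate `lam^(-1/(4m))`.

The kernel is linear algebra once the B-splines are known to be a basis. The jet map `splineJet`
bounds the dimension by `K + p`. The `K + p` B-splines lie in the space because their derivatives
are combinations of B-splines of one order less (`deBoor_mem_splineSpace`), and they are independent
by differentiation and partition of unity (`deBoor_coeff_eq_zero`). The form is positive definite on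
splines, so its Gram matrix is invertible, and the spline with coefficients `G⁻¹ B(t)` represents
evaluation at `t`. -/

/-! ### Polynomials of bounded degree on an interval -/

theorem Polynomial.exists_derivative_eq {n : ℕ} {T : Polynomial ℝ} (hT : T.degree < n) :
    ∃ Q : Polynomial ℝ, Q.degree < ((n + 1 : ℕ) : WithBot ℕ) ∧ Polynomial.derivative Q = T := by
  refine ⟨∑ k ∈ Finset.range n, Polynomial.monomial (k + 1) (T.coeff k / (k + 1)), ?_, ?_⟩
  · refine (Polynomial.degree_sum_le _ _).trans_lt ((Finset.sup_lt_iff (WithBot.bot_lt_coe _)).2 ?_)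
    intro k hk
    refine (Polynomial.degree_monomial_le _ _).trans_lt ?_
    have := Finset.mem_range.1 hk
    exact_mod_cast Nat.succ_lt_succ this
  · rw [Polynomial.derivative_sum]
    have h : ∀ k : ℕ, Polynomial.derivative (Polynomial.monomial (k + 1) (T.coeff k / (k + 1)))
        = Polynomial.monomial k (T.coeff k) := fun k => by
      rw [Polynomial.derivative_monomial]
      congr 1
      push_cast
      field_simp
    simp only [h]
    ext k
    rw [Polynomial.finsetSum_coeff]
    simp only [Polynomial.coeff_monomial, Finset.sum_ite_eq', Finset.mem_range]
    split_ifs with hk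
    · rfl
    · exact (Polynomial.coeff_eq_zero_of_degree_lt
        (hT.trans_le (by exact_mod_cast not_lt.1 hk))).symm

theorem Polynomial.eval_eq_sum_fin {n : ℕ} {T : Polynomial ℝ} (hT : T.degree < n) (t : ℝ) :
    T.eval t = ∑ i : Fin n, T.coeff i * t ^ (i : ℕ) := by
  rcases eq_or_ne T 0 with rfl | h0
  · simp
  rw [Polynomial.eval_eq_sum_range' ((Polynomial.natDegree_lt_iff_degree_lt h0).2 hT),
    Finset.sum_range]

/-- The integral is a continuous quadratic form in the coefficients, positive on the compact unit
sphere because a nonzero polynomial has finitely many roots; homogeneity does the rest. -/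
theorem exists_coeff_norm_sq_le_integral (n : ℕ) :
    ∃ a : ℝ, 0 < a ∧ ∀ c : Fin n → ℝ,
      a * ‖c‖ ^ 2 ≤ ∫ t in (0 : ℝ)..1, (∑ i, c i * t ^ (i : ℕ)) ^ 2 := by
  have hcont : Continuous fun c : Fin n → ℝ => ∫ t in (0 : ℝ)..1, (∑ i, c i * t ^ (i : ℕ)) ^ 2 := by
    apply intervalIntegral.continuous_parametric_intervalIntegral_of_continuous'
    simp only [Function.uncurry_def]
    fun_prop
  have hpos : ∀ c ∈ Metric.sphere (0 : Fin n → ℝ) 1,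
      0 < ∫ t in (0 : ℝ)..1, (∑ i, c i * t ^ (i : ℕ)) ^ 2 := by
    intro c hc
    have hc0 : c ≠ 0 := by
      rintro rfl
      simp at hc
    obtain ⟨i, hi⟩ := Function.ne_iff.1 hc0
    set T : Polynomial ℝ := ∑ i : Fin n, Polynomial.monomial (i : ℕ) (c i) with hT
    have hev : ∀ t, T.eval t = ∑ i, c i * t ^ (i : ℕ) := fun t => by
      simp [hT, Polynomial.eval_finsetSum]
    have hT0 : T ≠ 0 := by
      intro h
      apply hi
      have : T.coeff (i : ℕ) = c i := by
        simp [hT, Polynomial.coeff_monomial, ← Fin.ext_iff]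
      rw [← this, h]
      simp
    have hex : ∃ t ∈ Set.Icc (0 : ℝ) 1, T.eval t ≠ 0 := by
      by_contra! hall
      exact hT0 (Polynomial.eq_zero_of_infinite_isRoot T
        ((Set.Icc_infinite zero_lt_one).mono hall))
    refine intervalIntegral.integral_pos zero_lt_one (by fun_prop) (fun _ _ => sq_nonneg _) ?_
    obtain ⟨t, ht, h⟩ := hex
    exact ⟨t, ht, by rw [← hev]; positivity⟩
  obtain ⟨a, ha, h⟩ := (isCompact_sphere (0 : Fin n → ℝ) 1).exists_forall_le' hcont.continuousOn hpos
  refine ⟨a, ha, fun c => ?_⟩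
  rcases eq_or_ne c 0 with rfl | hc
  · simp
  have hn : ‖c‖ ≠ 0 := norm_ne_zero_iff.2 hc
  have h1 := h (‖c‖⁻¹ • c) (by simp [norm_smul, hn])
  have h2 : ∀ t : ℝ, (∑ i, (‖c‖⁻¹ • c) i * t ^ (i : ℕ)) ^ 2
      = (‖c‖ ^ 2)⁻¹ * (∑ i, c i * t ^ (i : ℕ)) ^ 2 := fun t => by
    simp only [Pi.smul_apply, smul_eq_mul, mul_assoc, ← Finset.mul_sum]
    rw [mul_pow, inv_pow]
  simp only [h2, intervalIntegral.integral_const_mul] at h1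
  rw [inv_mul_eq_div, le_div_iff₀ (by positivity)] at h1
  exact h1

/-- Polynomials of bounded degree on an interval: the supremum is bounded by the normalized
`L²`-norm. -/
theorem exists_polynomial_sq_le_integral (n : ℕ) :
    ∃ C : ℝ, 0 < C ∧ ∀ T : Polynomial ℝ, T.degree < n → ∀ a h : ℝ, 0 < h →
      ∀ s ∈ Set.Icc a (a + h), (T.eval s) ^ 2 ≤ C * (h⁻¹ * ∫ t in a..(a + h), (T.eval t) ^ 2) := by
  obtain ⟨α, hα, hle⟩ := exists_coeff_norm_sq_le_integral n
  -- `n²` comes from `|U(r)| ≤ n ‖c‖` on the unit interval, where `U` is the rescaled `T`; the `+ 1`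
  -- keeps the constant positive when `n = 0`.
  refine ⟨(n ^ 2 + 1) / α, by positivity, fun T hT a h hh s hs => ?_⟩
  set U : Polynomial ℝ := T.comp (Polynomial.C h * Polynomial.X + Polynomial.C a) with hU
  have hUe : ∀ t, U.eval t = T.eval (h * t + a) := fun t => by simp [hU, Polynomial.eval_comp]
  have hUd : U.degree < n := by
    rcases eq_or_ne T 0 with rfl | hT0
    · simp [hU]
    · have h1 : U.natDegree = T.natDegree := by
        rw [hU, Polynomial.natDegree_comp, Polynomial.natDegree_linear hh.ne', mul_one]
      have h2 := (Polynomial.natDegree_lt_iff_degree_lt hT0).2 hT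
      refine Polynomial.degree_le_natDegree.trans_lt ?_
      exact_mod_cast h1 ▸ h2
  have hint : h⁻¹ * ∫ t in a..(a + h), (T.eval t) ^ 2 = ∫ t in (0 : ℝ)..1, (U.eval t) ^ 2 := by
    simp only [hUe]
    rw [intervalIntegral.integral_comp_mul_add (fun x => (T.eval x) ^ 2) hh.ne' a]
    simp [add_comm]
  set r := (s - a) / h with hr
  have hs' : T.eval s = U.eval r := by
    rw [hUe, hr]
    congr 1
    field_simp
    ring
  have hr0 : 0 ≤ r := div_nonneg (by linarith [hs.1]) hh.le
  have hr1 : r ≤ 1 := by rw [hr, div_le_one hh]; linarith [hs.2]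
  set c : Fin n → ℝ := fun i => U.coeff i with hc
  have hb := hle c
  rw [hint, hs']
  have hsum : |U.eval r| ≤ n * ‖c‖ := by
    rw [Polynomial.eval_eq_sum_fin hUd]
    refine (Finset.abs_sum_le_sum_abs _ _).trans ?_
    have : ∀ i ∈ (Finset.univ : Finset (Fin n)), |U.coeff i * r ^ (i : ℕ)| ≤ ‖c‖ := fun i _ => by
      rw [abs_mul, abs_of_nonneg (pow_nonneg hr0 _)]
      calc |U.coeff i| * r ^ (i : ℕ) ≤ |U.coeff i| * 1 := by
            gcongr
            exact pow_le_one₀ hr0 hr1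
        _ = ‖c i‖ := by simp [hc]
        _ ≤ ‖c‖ := norm_le_pi_norm c i
    simpa using Finset.sum_le_card_nsmul _ _ _ this
  simp only [Polynomial.eval_eq_sum_fin hUd] at hsum ⊢
  set J := ∫ t in (0 : ℝ)..1, (∑ i : Fin n, U.coeff i * t ^ (i : ℕ)) ^ 2
  rw [div_mul_eq_mul_div, le_div_iff₀ hα]
  calc _ ≤ (n * ‖c‖) ^ 2 * α := by
        rw [← sq_abs]
        gcongr
    _ = n ^ 2 * (α * ‖c‖ ^ 2) := by ring
    _ ≤ n ^ 2 * J := by gcongr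
    _ ≤ (n ^ 2 + 1) * J := by nlinarith [mul_nonneg hα.le (sq_nonneg ‖c‖)]

/-! ### A Sobolev inequality with explicit dependence on the length -/

/-- Cauchy-Schwarz against the constant `1`, obtained by expanding `∫ (L u - A)² ≥ 0`. -/
theorem sq_integral_le {u : ℝ → ℝ} {a b : ℝ} (hab : a ≤ b)
    (hu : IntervalIntegrable u MeasureTheory.volume a b)
    (hu2 : IntervalIntegrable (fun t => u t ^ 2) MeasureTheory.volume a b) :
    (∫ t in a..b, u t) ^ 2 ≤ (b - a) * ∫ t in a..b, u t ^ 2 := by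
  rcases hab.eq_or_lt with rfl | hlt
  · simp
  set A := ∫ t in a..b, u t with hA
  set L := b - a with hL
  have hLpos : 0 < L := sub_pos.2 hlt
  have h0 : 0 ≤ ∫ t in a..b, (L * u t - A) ^ 2 :=
    intervalIntegral.integral_nonneg hab fun _ _ => sq_nonneg _
  have h1 : ∫ t in a..b, (L * u t - A) ^ 2
      = L ^ 2 * (∫ t in a..b, u t ^ 2) - 2 * L * A * A + A ^ 2 * L := by
    have : ∀ t, (L * u t - A) ^ 2 = (L ^ 2 * u t ^ 2 - 2 * L * A * u t) + A ^ 2 := fun t => by ring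
    simp only [this]
    rw [intervalIntegral.integral_add ((hu2.const_mul _).sub (hu.const_mul _)) (by simp),
      intervalIntegral.integral_sub (hu2.const_mul _) (hu.const_mul _),
      intervalIntegral.integral_const_mul, intervalIntegral.integral_const_mul,
      intervalIntegral.integral_const, ← hA]
    simp only [smul_eq_mul]
    ring
  rw [h1] at h0
  have : 0 ≤ L * (L * (∫ t in a..b, u t ^ 2) - A ^ 2) := by linarith
  linarith [nonneg_of_mul_nonneg_right this hLpos]

/-- Taylor approximation for a chain of iterated antiderivatives `F 0, F 1, …, F (m + 1)`. -/
theorem exists_taylor_polynomial (m : ℕ) : ∀ (F : ℕ → ℝ → ℝ) (a h B : ℝ), 0 ≤ h →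
    (∀ k ≤ m, IntervalIntegrable (F (k + 1)) MeasureTheory.volume a (a + h)) →
    (∀ k ≤ m, ∀ s ∈ Set.Icc a (a + h), ∫ t in a..s, F (k + 1) t = F k s - F k a) →
    (∀ s ∈ Set.Icc a (a + h), |∫ t in a..s, F (m + 1) t| ≤ B) →
    ∃ T : Polynomial ℝ, T.degree < ((m + 1 : ℕ) : WithBot ℕ) ∧
      ∀ s ∈ Set.Icc a (a + h), |F 0 s - T.eval s| ≤ h ^ m * B := by
  induction m with
  | zero =>
    intro F a h B _ _ hF hB
    refine ⟨Polynomial.C (F 0 a), Polynomial.degree_C_le.trans_lt (by norm_num), fun s hs => ?_⟩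
    have := hB s hs
    rw [hF 0 le_rfl s hs] at this
    simpa using this
  | succ m ih =>
    intro F a h B hh hi hF hB
    -- Approximate the shifted chain, then integrate: an antiderivative of `T` with value `F 0 a` at
    -- `a` approximates `F 0`, and the integration costs one factor `h`.
    obtain ⟨T, hT, hTb⟩ := ih (fun k => F (k + 1)) a h B hh
      (fun k hk => hi (k + 1) (by omega)) (fun k hk => hF (k + 1) (by omega)) hB
    obtain ⟨Q, hQ, hQd⟩ := Polynomial.exists_derivative_eq hT
    refine ⟨Q + Polynomial.C (F 0 a - Q.eval a), ?_, fun s hs => ?_⟩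
    · refine (Polynomial.degree_add_le _ _).trans_lt (max_lt hQ ?_)
      exact Polynomial.degree_C_le.trans_lt (by exact_mod_cast Nat.succ_pos _)
    · have hQi : ∫ t in a..s, T.eval t = Q.eval s - Q.eval a := by
        rw [← hQd]
        exact intervalIntegral.integral_eq_sub_of_hasDerivAt (fun x _ => Q.hasDerivAt x)
          ((Polynomial.continuous _).intervalIntegrable _ _)
      have hsub : Set.uIcc a s ⊆ Set.uIcc a (a + h) := by
        rw [Set.uIcc_of_le hs.1, Set.uIcc_of_le (by linarith)]
        exact Set.Icc_subset_Icc_right hs.2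
      have hdiff : F 0 s - (Q + Polynomial.C (F 0 a - Q.eval a)).eval s
          = ∫ t in a..s, (F 1 t - T.eval t) := by
        rw [intervalIntegral.integral_sub ((hi 0 (by omega)).mono_set hsub)
          ((Polynomial.continuous _).intervalIntegrable _ _), hQi, hF 0 (by omega) s hs]
        simp
        ring
      rw [hdiff]
      have hle : ∀ t ∈ Set.uIoc a s, ‖F 1 t - T.eval t‖ ≤ h ^ m * B := fun t ht => by
        rw [Set.uIoc_of_le hs.1] at ht
        exact hTb t ⟨ht.1.le, ht.2.trans hs.2⟩
      refine (intervalIntegral.norm_integral_le_of_norm_le_const hle).trans ?_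
      have h0 : 0 ≤ h ^ m * B := (abs_nonneg _).trans (hTb s hs)
      rw [abs_of_nonneg (by linarith [hs.1])]
      calc h ^ m * B * (s - a) ≤ h ^ m * B * h := by
            gcongr
            linarith [hs.2]
        _ = h ^ (m + 1) * B := by ring

/-- A Sobolev inequality on an interval of length `h`. -/
theorem exists_sobolev_const (m : ℕ) :
    ∃ C : ℝ, 0 < C ∧ ∀ (F : ℕ → ℝ → ℝ) (a h : ℝ), 0 < h →
      ContinuousOn (F 0) (Set.Icc a (a + h)) →
      (∀ k ≤ m, IntervalIntegrable (F (k + 1)) MeasureTheory.volume a (a + h)) →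
      (∀ k ≤ m, ∀ s ∈ Set.Icc a (a + h), ∫ t in a..s, F (k + 1) t = F k s - F k a) →
      IntervalIntegrable (fun t => F (m + 1) t ^ 2) MeasureTheory.volume a (a + h) →
      ∀ s ∈ Set.Icc a (a + h), F 0 s ^ 2 ≤ C * (h⁻¹ * ((∫ t in a..(a + h), F 0 t ^ 2)
        + h ^ (2 * (m + 1)) * ∫ t in a..(a + h), F (m + 1) t ^ 2)) := by
  obtain ⟨C, hC, hpoly⟩ := exists_polynomial_sq_le_integral (m + 1)
  -- From `F² ≤ 2 T² + 2 R` and `T² ≤ C h⁻¹ ∫ T² ≤ C (2 h⁻¹ ∫ F² + 2 R)`, where `T` is the Taylor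
  -- polynomial and `R` bounds the squared error.
  refine ⟨4 * C + 2, by positivity, fun F a h hh hcont hi hF hi2 s hs => ?_⟩
  set E := ∫ t in a..(a + h), F (m + 1) t ^ 2 with hE
  have hE0 : 0 ≤ E := intervalIntegral.integral_nonneg (by linarith) fun _ _ => sq_nonneg _
  have hB : ∀ s ∈ Set.Icc a (a + h), |∫ t in a..s, F (m + 1) t| ≤ √(h * E) := fun s hs => by
    have hsub : Set.uIcc a s ⊆ Set.uIcc a (a + h) := by
      rw [Set.uIcc_of_le hs.1, Set.uIcc_of_le (by linarith)]
      exact Set.Icc_subset_Icc_right hs.2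
    refine Real.abs_le_sqrt ((sq_integral_le hs.1 ((hi m le_rfl).mono_set hsub)
      (hi2.mono_set hsub)).trans ?_)
    have hmono : ∫ t in a..s, F (m + 1) t ^ 2 ≤ E :=
      intervalIntegral.integral_mono_interval le_rfl hs.1 hs.2
        (Eventually.of_forall fun _ => sq_nonneg _) hi2
    have h0 : 0 ≤ ∫ t in a..s, F (m + 1) t ^ 2 :=
      intervalIntegral.integral_nonneg hs.1 fun _ _ => sq_nonneg _
    exact mul_le_mul (by linarith [hs.2]) hmono h0 hh.le
  obtain ⟨T, hT, hTb⟩ := exists_taylor_polynomial m F a h _ hh.le hi hF hB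
  set R := h ^ (2 * m + 1) * E with hR
  have hR0 : 0 ≤ R := by positivity
  have hTR : ∀ s ∈ Set.Icc a (a + h), (F 0 s - T.eval s) ^ 2 ≤ R := fun s hs => by
    rw [← sq_abs]
    calc _ ≤ (h ^ m * √(h * E)) ^ 2 := by gcongr; exact hTb s hs
      _ = R := by rw [mul_pow, Real.sq_sqrt (by positivity), hR]; ring
  have hab : a ≤ a + h := by linarith
  have hF0i : IntervalIntegrable (fun t => F 0 t ^ 2) MeasureTheory.volume a (a + h) := by
    apply ContinuousOn.intervalIntegrable
    rw [Set.uIcc_of_le hab]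
    exact hcont.pow 2
  have hTi : ∫ t in a..(a + h), T.eval t ^ 2
      ≤ 2 * (∫ t in a..(a + h), F 0 t ^ 2) + 2 * (h * R) := by
    calc _ ≤ ∫ t in a..(a + h), (2 * F 0 t ^ 2 + 2 * R) := by
          refine intervalIntegral.integral_mono_on hab
            (((Polynomial.continuous T).pow 2).intervalIntegrable _ _)
            ((hF0i.const_mul 2).add (by simp)) fun t ht => ?_
          nlinarith [hTR t ht, sq_nonneg (2 * F 0 t - T.eval t)]
      _ = _ := by
          rw [intervalIntegral.integral_add (hF0i.const_mul 2) (by simp),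
            intervalIntegral.integral_const_mul, intervalIntegral.integral_const]
          simp
          ring
  have h1 : F 0 s ^ 2 ≤ 2 * T.eval s ^ 2 + 2 * R := by
    nlinarith [hTR s hs, sq_nonneg (F 0 s - 2 * T.eval s)]
  have h2 := hpoly T hT a h hh s hs
  set J := ∫ t in a..(a + h), F 0 t ^ 2
  have hJ0 : 0 ≤ J := intervalIntegral.integral_nonneg hab fun _ _ => sq_nonneg _
  have h3 : h⁻¹ * (∫ t in a..(a + h), T.eval t ^ 2) ≤ 2 * (h⁻¹ * J) + 2 * R := by
    calc _ ≤ h⁻¹ * (2 * J + 2 * (h * R)) := by gcongr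
      _ = _ := by field_simp
  have h4 : h⁻¹ * (J + h ^ (2 * (m + 1)) * E) = h⁻¹ * J + R := by
    rw [hR]
    field_simp
    ring
  rw [h4]
  have h5 : 0 ≤ h⁻¹ * J := by positivity
  nlinarith [mul_le_mul_of_nonneg_left h3 hC.le]

namespace PenalizedSpline

/-! ### Knot intervals and piecewise polynomials -/

section Knots

variable {K : ℕ} {x : Fin (K + 2) → ℝ}

theorem IsKnotVector.nonneg (hx : IsKnotVector x) (i : Fin (K + 2)) : 0 ≤ x i :=
  hx.left ▸ hx.strictMono.monotone (Fin.zero_le i)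

theorem IsKnotVector.le_one (hx : IsKnotVector x) (i : Fin (K + 2)) : x i ≤ 1 :=
  hx.right ▸ hx.strictMono.monotone (Fin.le_last i)

theorem IsKnotVector.castSucc_lt_succ (hx : IsKnotVector x) (i : Fin (K + 1)) :
    x i.castSucc < x i.succ :=
  hx.strictMono i.castSucc_lt_succ

theorem IsKnotVector.Icc_subset (hx : IsKnotVector x) (i : Fin (K + 1)) :
    Set.Icc (x i.castSucc) (x i.succ) ⊆ Set.Icc 0 1 :=
  Set.Icc_subset_Icc (hx.nonneg _) (hx.le_one _)

theorem IsKnotVector.Ioo_subset (hx : IsKnotVector x) (i : Fin (K + 1)) :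
    Set.Ioo (x i.castSucc) (x i.succ) ⊆ Set.Ioo 0 1 :=
  Set.Ioo_subset_Ioo (hx.nonneg _) (hx.le_one _)

theorem IsKnotVector.notMem_range (hx : IsKnotVector x) {i : Fin (K + 1)} {s : ℝ}
    (hs : s ∈ Set.Ioo (x i.castSucc) (x i.succ)) : s ∉ Set.range x := by
  rintro ⟨j, rfl⟩
  have h1 := hx.strictMono.lt_iff_lt.1 hs.1
  have h2 := hx.strictMono.lt_iff_lt.1 hs.2
  simp only [Fin.lt_def, Fin.val_castSucc, Fin.val_succ] at h1 h2
  omega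

theorem IsKnotVector.exists_mem_Ioo (hx : IsKnotVector x) {s : ℝ} (hs : s ∈ Set.Ioo (0 : ℝ) 1)
    (hs' : s ∉ Set.range x) : ∃ i : Fin (K + 1), s ∈ Set.Ioo (x i.castSucc) (x i.succ) := by
  by_contra! h
  have hall : ∀ i : Fin (K + 2), x i < s := by
    intro i
    induction i using Fin.induction with
    | zero => rw [hx.left]; exact hs.1
    | succ i ih =>
      rcases lt_trichotomy (x i.succ) s with h1 | h1 | h1
      · exact h1
      · exact absurd ⟨_, h1⟩ hs'
      · exact absurd ⟨ih, h1⟩ (h i)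
  have := hall (Fin.last _)
  rw [hx.right] at this
  exact lt_asymm this hs.2

theorem IsKnotVector.exists_mem_Icc (hx : IsKnotVector x) {s : ℝ} (hs : s ∈ Set.Icc (0 : ℝ) 1) :
    ∃ i : Fin (K + 1), s ∈ Set.Icc (x i.castSucc) (x i.succ) := by
  by_contra! h
  have hall : ∀ i : Fin (K + 2), x i ≤ s := by
    intro i
    induction i using Fin.induction with
    | zero => rw [hx.left]; exact hs.1
    | succ i ih =>
      by_contra! h1
      exact h i ⟨ih, h1.le⟩
  exact h (Fin.last K) ⟨hall _, by rw [Fin.succ_last, hx.right]; exact hs.2⟩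

theorem ae_notMem_range_knots : ∀ᵐ s : ℝ, s ∉ Set.range x :=
  (Set.finite_range x).countable.ae_notMem _

/-- On every open interval between consecutive knots, `u` is given by a polynomial. -/
def PiecewisePolynomial (x : Fin (K + 2) → ℝ) (u : ℝ → ℝ) : Prop :=
  ∀ i : Fin (K + 1), ∃ P : Polynomial ℝ,
    ∀ s ∈ Set.Ioo (x i.castSucc) (x i.succ), u s = P.eval s

theorem PiecewisePolynomial.mul {u v : ℝ → ℝ} (hu : PiecewisePolynomial x u)
    (hv : PiecewisePolynomial x v) : PiecewisePolynomial x fun t => u t * v t := fun i => by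
  obtain ⟨P, hP⟩ := hu i
  obtain ⟨Q, hQ⟩ := hv i
  exact ⟨P * Q, fun s hs => by simp [hP s hs, hQ s hs]⟩

/-- The values at the knots are arbitrary, but the knots form a null set. -/
theorem PiecewisePolynomial.intervalIntegrable {u : ℝ → ℝ} (hu : PiecewisePolynomial x u)
    (hx : IsKnotVector x) {a b : ℝ} (ha : a ∈ Set.Icc (0 : ℝ) 1) (hb : b ∈ Set.Icc (0 : ℝ) 1) :
    IntervalIntegrable u MeasureTheory.volume a b := by
  have h01 : IntervalIntegrable u MeasureTheory.volume 0 1 := by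
    rw [intervalIntegrable_iff_integrableOn_Ioo_of_le zero_le_one]
    have h1 : MeasureTheory.IntegrableOn u
        (⋃ i : Fin (K + 1), Set.Ioo (x i.castSucc) (x i.succ)) := by
      rw [MeasureTheory.integrableOn_finite_iUnion]
      intro i
      obtain ⟨P, hP⟩ := hu i
      refine MeasureTheory.IntegrableOn.congr_fun ?_ (fun s hs => (hP s hs).symm) measurableSet_Ioo
      exact (P.continuous.continuousOn.integrableOn_Icc).mono_set Set.Ioo_subset_Icc_self
    have h2 : MeasureTheory.IntegrableOn u (Set.range x) := by
      refine MeasureTheory.IntegrableOn.of_measure_zero ?_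
      exact (Set.finite_range x).measure_zero _
    refine (h1.union h2).mono_set fun s hs => ?_
    by_cases h : s ∈ Set.range x
    · exact Or.inr h
    · exact Or.inl (Set.mem_iUnion.2 (hx.exists_mem_Ioo hs h))
  refine h01.mono_set ?_
  rw [Set.uIcc_of_le (zero_le_one' ℝ)]
  exact Set.uIcc_subset_Icc ha hb

/-- Two functions that agree between the knots have the same integral. -/
theorem integral_congr_knots (hx : IsKnotVector x) {u v : ℝ → ℝ} {a b : ℝ}
    (ha : a ∈ Set.Icc (0 : ℝ) 1) (hb : b ∈ Set.Icc (0 : ℝ) 1)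
    (h : ∀ i : Fin (K + 1), ∀ s ∈ Set.Ioo (x i.castSucc) (x i.succ), u s = v s) :
    ∫ t in a..b, u t = ∫ t in a..b, v t := by
  refine intervalIntegral.integral_congr_ae ?_
  filter_upwards [ae_notMem_range_knots (x := x)] with s hs hsab
  have h01 := Set.uIcc_subset_Icc ha hb (Set.uIoc_subset_uIcc hsab)
  have h0 : s ≠ 0 := fun h => hs ⟨0, by rw [hx.left, h]⟩
  have h1 : s ≠ 1 := fun h => hs ⟨Fin.last _, by rw [hx.right, h]⟩
  obtain ⟨i, hi⟩ := hx.exists_mem_Ioo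
    ⟨lt_of_le_of_ne h01.1 h0.symm, lt_of_le_of_ne h01.2 h1⟩ hs
  exact h i s hi

end Knots

theorem extend_apply (f : I → ℝ) {t : ℝ} (ht : t ∈ Set.Icc (0 : ℝ) 1) :
    extend f t = f ⟨t, ht⟩ :=
  Set.IccExtend_of_mem _ _ ht

theorem extend_coe (f : I → ℝ) (t : I) : extend f t = f t :=
  Set.IccExtend_val _ _ t

theorem der_zero (f : I → ℝ) : der 0 f = extend f :=
  iteratedDerivWithin_zero

theorem iteratedDerivWithin_polynomial (P : Polynomial ℝ) (k : ℕ) {s : ℝ}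
    (hs : s ∈ Set.Icc (0 : ℝ) 1) :
    iteratedDerivWithin k (fun t => P.eval t) (Set.Icc 0 1) s
      = (Polynomial.derivative^[k] P).eval s := by
  induction k generalizing P with
  | zero => simp
  | succ k ih =>
    rw [iteratedDerivWithin_succ', Function.iterate_succ_apply, ← ih]
    refine iteratedDerivWithin_congr (fun t ht => ?_) hs
    exact P.derivWithin (uniqueDiffOn_Icc_zero_one t ht)

/-! ### Derivatives of splines, the penalized form, and the dimension bound -/

section Spline

variable {K p : ℕ} {x : Fin (K + 2) → ℝ} {f g : I → ℝ}

theorem exists_polynomial_of_mem (hx : IsKnotVector x) (hf : f ∈ splineSpace p x)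
    (i : Fin (K + 1)) : ∃ P : Polynomial ℝ, P.degree < (p : WithBot ℕ) ∧
      ∀ s ∈ Set.Icc (x i.castSucc) (x i.succ), extend f s = P.eval s := by
  obtain ⟨P, hP, h⟩ := hf.2 i
  refine ⟨P, hP, fun s hs => ?_⟩
  rw [extend_apply f (hx.Icc_subset i hs)]
  exact h ⟨s, hx.Icc_subset i hs⟩ hs

/-- Derivatives are local, so an open knot interval is needed: at a knot two polynomial pieces meet.
-/
theorem der_eq_of_eq_polynomial (hx : IsKnotVector x) {i : Fin (K + 1)} {P : Polynomial ℝ}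
    (hP : ∀ s ∈ Set.Icc (x i.castSucc) (x i.succ), extend f s = P.eval s) (k : ℕ) {s : ℝ}
    (hs : s ∈ Set.Ioo (x i.castSucc) (x i.succ)) :
    der k f s = (Polynomial.derivative^[k] P).eval s := by
  rw [← iteratedDerivWithin_polynomial P k (Set.Ioo_subset_Icc_self (hx.Ioo_subset i hs))]
  refine Filter.EventuallyEq.iteratedDerivWithin_eq ?_ (hP s (Set.Ioo_subset_Icc_self hs))
  refine Filter.Eventually.filter_mono nhdsWithin_le_nhds ?_
  filter_upwards [isOpen_Ioo.mem_nhds hs] with t ht using hP t (Set.Ioo_subset_Icc_self ht)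

theorem piecewisePolynomial_der (hx : IsKnotVector x) (hf : f ∈ splineSpace p x) (k : ℕ) :
    PiecewisePolynomial x (der k f) := fun i => by
  obtain ⟨P, -, hP⟩ := exists_polynomial_of_mem hx hf i
  exact ⟨_, fun s hs => der_eq_of_eq_polynomial hx hP k hs⟩

theorem der_add_of_mem_Ioo (hx : IsKnotVector x) (hf : f ∈ splineSpace p x)
    (hg : g ∈ splineSpace p x) (k : ℕ) {i : Fin (K + 1)} {s : ℝ}
    (hs : s ∈ Set.Ioo (x i.castSucc) (x i.succ)) : der k (f + g) s = der k f s + der k g s := by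
  obtain ⟨P, -, hP⟩ := exists_polynomial_of_mem hx hf i
  obtain ⟨Q, -, hQ⟩ := exists_polynomial_of_mem hx hg i
  have hPQ : ∀ s ∈ Set.Icc (x i.castSucc) (x i.succ), extend (f + g) s = (P + Q).eval s :=
    fun s hs => by rw [Polynomial.eval_add, ← hP s hs, ← hQ s hs]; rfl
  rw [der_eq_of_eq_polynomial hx hP k hs, der_eq_of_eq_polynomial hx hQ k hs,
    der_eq_of_eq_polynomial hx hPQ k hs, iterate_map_add, Polynomial.eval_add]

theorem der_smul_of_mem_Ioo (hx : IsKnotVector x) (hf : f ∈ splineSpace p x) (c : ℝ) (k : ℕ)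
    {i : Fin (K + 1)} {s : ℝ} (hs : s ∈ Set.Ioo (x i.castSucc) (x i.succ)) :
    der k (c • f) s = c * der k f s := by
  obtain ⟨P, -, hP⟩ := exists_polynomial_of_mem hx hf i
  have hcP : ∀ s ∈ Set.Icc (x i.castSucc) (x i.succ), extend (c • f) s = (c • P).eval s :=
    fun s hs => by rw [Polynomial.eval_smul, ← hP s hs]; rfl
  rw [der_eq_of_eq_polynomial hx hP k hs, der_eq_of_eq_polynomial hx hcP k hs,
    Polynomial.iterate_derivative_smul, Polynomial.eval_smul, smul_eq_mul]

theorem contDiffOn_extend (hf : f ∈ splineSpace p x) :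
    ContDiffOn ℝ ((p - 2 : ℕ) : WithTop ℕ∞) (extend f) (Set.Icc 0 1) :=
  hf.1

theorem continuousOn_der (hf : f ∈ splineSpace p x) {k : ℕ} (hk : k ≤ p - 2) :
    ContinuousOn (der k f) (Set.Icc 0 1) :=
  (contDiffOn_extend hf).continuousOn_iteratedDerivWithin (by exact_mod_cast hk)
    uniqueDiffOn_Icc_zero_one

theorem continuousOn_extend (hf : f ∈ splineSpace p x) :
    ContinuousOn (extend f) (Set.Icc 0 1) :=
  (contDiffOn_extend hf).continuousOn

theorem hasDerivAt_der (hx : IsKnotVector x) (hf : f ∈ splineSpace p x) (k : ℕ) {s : ℝ}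
    {i : Fin (K + 1)} (hs : s ∈ Set.Ioo (x i.castSucc) (x i.succ)) :
    HasDerivAt (der k f) (der (k + 1) f s) s := by
  obtain ⟨P, -, hP⟩ := exists_polynomial_of_mem hx hf i
  rw [der_eq_of_eq_polynomial hx hP (k + 1) hs, Function.iterate_succ_apply']
  refine (Polynomial.hasDerivAt _ s).congr_of_eventuallyEq ?_
  filter_upwards [isOpen_Ioo.mem_nhds hs] with t ht using der_eq_of_eq_polynomial hx hP k ht

/-- The fundamental theorem of calculus with finitely many exceptional points. The case `k = p - 2`
reaches the possibly discontinuous derivative of order `p - 1`. -/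
theorem integral_der (hx : IsKnotVector x) (hf : f ∈ splineSpace p x) {k : ℕ} (hk : k ≤ p - 2)
    {a b : ℝ} (ha : a ∈ Set.Icc (0 : ℝ) 1) (hb : b ∈ Set.Icc (0 : ℝ) 1) :
    ∫ t in a..b, der (k + 1) f t = der k f b - der k f a := by
  refine MeasureTheory.integral_eq_of_hasDerivAt_off_countable (s := Set.range x) _ _
    (Set.finite_range x).countable ((continuousOn_der hf hk).mono (Set.uIcc_subset_Icc ha hb))
    (fun s hs => ?_) ((piecewisePolynomial_der hx hf _).intervalIntegrable hx ha hb)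
  have hs01 : s ∈ Set.Ioo (0 : ℝ) 1 :=
    ⟨(le_min ha.1 hb.1).trans_lt hs.1.1, hs.1.2.trans_le (max_le ha.2 hb.2)⟩
  obtain ⟨i, hi⟩ := hx.exists_mem_Ioo hs01 hs.2
  exact hasDerivAt_der hx hf k hi

theorem intervalIntegrable_der_mul_der (hx : IsKnotVector x) (hf : f ∈ splineSpace p x)
    (hg : g ∈ splineSpace p x) (k : ℕ) {a b : ℝ} (ha : a ∈ Set.Icc (0 : ℝ) 1)
    (hb : b ∈ Set.Icc (0 : ℝ) 1) :
    IntervalIntegrable (fun t => der k f t * der k g t) MeasureTheory.volume a b :=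
  ((piecewisePolynomial_der hx hf k).mul (piecewisePolynomial_der hx hg k)).intervalIntegrable
    hx ha hb

theorem l2Inner_comm (u v : ℝ → ℝ) : l2Inner u v = l2Inner v u := by
  simp only [l2Inner, mul_comm]

theorem penInner_comm (m : ℕ) (lam : ℝ) (f g : I → ℝ) :
    penInner m lam f g = penInner m lam g f := by
  simp only [penInner, l2Inner_comm (extend f), l2Inner_comm (der m f)]

theorem l2Inner_der_add_left (hx : IsKnotVector x) {f₁ f₂ : I → ℝ} (hf₁ : f₁ ∈ splineSpace p x)
    (hf₂ : f₂ ∈ splineSpace p x) (hg : g ∈ splineSpace p x) (k : ℕ) :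
    l2Inner (der k (f₁ + f₂)) (der k g)
      = l2Inner (der k f₁) (der k g) + l2Inner (der k f₂) (der k g) := by
  have h0 : (0 : ℝ) ∈ Set.Icc (0 : ℝ) 1 := by simp
  have h1 : (1 : ℝ) ∈ Set.Icc (0 : ℝ) 1 := by simp
  unfold l2Inner
  rw [← intervalIntegral.integral_add (intervalIntegrable_der_mul_der hx hf₁ hg k h0 h1)
    (intervalIntegrable_der_mul_der hx hf₂ hg k h0 h1)]
  refine integral_congr_knots hx h0 h1 fun i s hs => ?_
  rw [der_add_of_mem_Ioo hx hf₁ hf₂ k hs, add_mul]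

theorem l2Inner_der_smul_left (hx : IsKnotVector x) (hf : f ∈ splineSpace p x) (c : ℝ) (k : ℕ)
    (v : ℝ → ℝ) : l2Inner (der k (c • f)) v = c * l2Inner (der k f) v := by
  have h0 : (0 : ℝ) ∈ Set.Icc (0 : ℝ) 1 := by simp
  have h1 : (1 : ℝ) ∈ Set.Icc (0 : ℝ) 1 := by simp
  unfold l2Inner
  rw [← intervalIntegral.integral_const_mul]
  refine integral_congr_knots hx h0 h1 fun i s hs => ?_
  rw [der_smul_of_mem_Ioo hx hf c k hs, mul_assoc]

theorem penInner_add_left (hx : IsKnotVector x) {f₁ f₂ : I → ℝ} (hf₁ : f₁ ∈ splineSpace p x)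
    (hf₂ : f₂ ∈ splineSpace p x) (hg : g ∈ splineSpace p x) (m : ℕ) (lam : ℝ) :
    penInner m lam (f₁ + f₂) g = penInner m lam f₁ g + penInner m lam f₂ g := by
  simp only [penInner, ← der_zero]
  rw [l2Inner_der_add_left hx hf₁ hf₂ hg, l2Inner_der_add_left hx hf₁ hf₂ hg]
  ring

theorem penInner_smul_left (hx : IsKnotVector x) (hf : f ∈ splineSpace p x) (c : ℝ) (m : ℕ)
    (lam : ℝ) (g : I → ℝ) : penInner m lam (c • f) g = c * penInner m lam f g := by
  simp only [penInner, ← der_zero]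
  rw [l2Inner_der_smul_left hx hf, l2Inner_der_smul_left hx hf]
  ring

/-- The penalized inner product as a bilinear form on the spline space. -/
noncomputable def penForm (hx : IsKnotVector x) (p m : ℕ) (lam : ℝ) :
    splineSpace p x →ₗ[ℝ] splineSpace p x →ₗ[ℝ] ℝ :=
  LinearMap.mk₂ ℝ (fun f g => penInner m lam f g)
    (fun f₁ f₂ g => penInner_add_left hx f₁.2 f₂.2 g.2 m lam)
    (fun c f g => penInner_smul_left hx f.2 c m lam g)
    (fun f g₁ g₂ => by
      simp only [penInner_comm m lam (f : I → ℝ)]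
      exact penInner_add_left hx g₁.2 g₂.2 f.2 m lam)
    (fun c f g => by
      simp only [penInner_comm m lam (f : I → ℝ)]
      exact penInner_smul_left hx g.2 c m lam f)

theorem penForm_apply (hx : IsKnotVector x) (m : ℕ) (lam : ℝ) (f g : splineSpace p x) :
    penForm hx p m lam f g = penInner m lam f g :=
  rfl

theorem l2Inner_self_nonneg (u : ℝ → ℝ) : 0 ≤ l2Inner u u :=
  intervalIntegral.integral_nonneg zero_le_one fun _ _ => mul_self_nonneg _

theorem penInner_self_nonneg (m : ℕ) {lam : ℝ} (hlam : 0 ≤ lam) (f : I → ℝ) :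
    0 ≤ penInner m lam f f :=
  add_nonneg (l2Inner_self_nonneg _) (mul_nonneg hlam (l2Inner_self_nonneg _))

/-- The `L²` part alone is definite on continuous functions, so `lam = 0` needs no separate
treatment. -/
theorem eq_zero_of_penInner_self_eq_zero (hf : f ∈ splineSpace p x) {m : ℕ} {lam : ℝ}
    (hlam : 0 ≤ lam) (h : penInner m lam f f = 0) : f = 0 := by
  by_contra hne
  obtain ⟨t, ht⟩ := Function.ne_iff.1 hne
  have hpos : 0 < l2Inner (extend f) (extend f) := by
    refine intervalIntegral.integral_pos zero_lt_one
      ((continuousOn_extend hf).mul (continuousOn_extend hf)) (fun _ _ => mul_self_nonneg _)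
      ⟨t, t.2, ?_⟩
    rw [extend_coe]
    exact mul_self_pos.2 ht
  have := mul_nonneg hlam (l2Inner_self_nonneg (der m f))
  unfold penInner at h
  linarith

/-- The derivatives of a spline at `0` up to order `p - 2` and the values of the
`(p-1)`-st derivative between the knots. -/
noncomputable def splineJet (hx : IsKnotVector x) (p : ℕ) :
    splineSpace p x →ₗ[ℝ] (Fin (p - 1) → ℝ) × (Fin (K + 1) → ℝ) where
  toFun f := (fun k => der k f 0, fun i => der (p - 1) f ((x i.castSucc + x i.succ) / 2))
  map_add' f g := by
    have h0 : (0 : ℝ) ∈ Set.Icc (0 : ℝ) 1 := by simp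
    refine Prod.ext (funext fun k => ?_) (funext fun i => ?_)
    · have hk : ((k : ℕ) : WithTop ℕ∞) ≤ ((p - 2 : ℕ) : WithTop ℕ∞) := by
        exact_mod_cast (by omega : (k : ℕ) ≤ p - 2)
      exact iteratedDerivWithin_add h0 uniqueDiffOn_Icc_zero_one
        (((contDiffOn_extend f.2).of_le hk) 0 h0) (((contDiffOn_extend g.2).of_le hk) 0 h0)
    · exact der_add_of_mem_Ioo hx f.2 g.2 _
        ⟨left_lt_add_div_two.2 (hx.castSucc_lt_succ i),
          add_div_two_lt_right.2 (hx.castSucc_lt_succ i)⟩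
  map_smul' c f := by
    have h0 : (0 : ℝ) ∈ Set.Icc (0 : ℝ) 1 := by simp
    refine Prod.ext (funext fun k => ?_) (funext fun i => ?_)
    · have hk : ((k : ℕ) : WithTop ℕ∞) ≤ ((p - 2 : ℕ) : WithTop ℕ∞) := by
        exact_mod_cast (by omega : (k : ℕ) ≤ p - 2)
      exact iteratedDerivWithin_const_smul h0 uniqueDiffOn_Icc_zero_one c
        (((contDiffOn_extend f.2).of_le hk) 0 h0)
    · exact der_smul_of_mem_Ioo hx f.2 c _
        ⟨left_lt_add_div_two.2 (hx.castSucc_lt_succ i),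
          add_div_two_lt_right.2 (hx.castSucc_lt_succ i)⟩

/-- The derivative of order `p - 1` is constant between knots, so zero midpoint values make it
vanish there; integrating `p - 1` times from zero data at `0` kills the spline. -/
theorem splineJet_injective (hx : IsKnotVector x) (hp : 2 ≤ p) :
    Function.Injective (splineJet hx p) := by
  rw [injective_iff_map_eq_zero]
  intro f hf
  have hf0 : ∀ k ≤ p - 2, der k (f : I → ℝ) 0 = 0 := fun k hk =>
    congr_fun (congr_arg Prod.fst hf) ⟨k, by omega⟩
  have hfm : ∀ i : Fin (K + 1),
      der (p - 1) (f : I → ℝ) ((x i.castSucc + x i.succ) / 2) = 0 := fun i =>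
    congr_fun (congr_arg Prod.snd hf) i
  have h0 : (0 : ℝ) ∈ Set.Icc (0 : ℝ) 1 := by simp
  have htop : ∀ i : Fin (K + 1), ∀ s ∈ Set.Ioo (x i.castSucc) (x i.succ),
      der (p - 1) (f : I → ℝ) s = 0 := fun i s hs => by
    obtain ⟨P, hPd, hP⟩ := exists_polynomial_of_mem hx f.2 i
    have hm : (x i.castSucc + x i.succ) / 2 ∈ Set.Ioo (x i.castSucc) (x i.succ) :=
      ⟨left_lt_add_div_two.2 (hx.castSucc_lt_succ i),
        add_div_two_lt_right.2 (hx.castSucc_lt_succ i)⟩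
    have hdeg : (Polynomial.derivative^[p - 1] P).natDegree = 0 := by
      have h1 := Polynomial.natDegree_iterate_derivative P (p - 1)
      have h2 : P.natDegree < p := by
        rcases eq_or_ne P 0 with rfl | hP0
        · simp; omega
        · exact (Polynomial.natDegree_lt_iff_degree_lt hP0).2 hPd
      omega
    have h1 := hfm i
    rw [der_eq_of_eq_polynomial hx hP _ hm, Polynomial.eq_C_of_natDegree_eq_zero hdeg,
      Polynomial.eval_C] at h1
    rw [der_eq_of_eq_polynomial hx hP _ hs, Polynomial.eq_C_of_natDegree_eq_zero hdeg,
      Polynomial.eval_C, h1]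
  have hall : ∀ j ≤ p - 2, ∀ s ∈ Set.Icc (0 : ℝ) 1, der (p - 2 - j) (f : I → ℝ) s = 0 := by
    intro j
    induction j with
    | zero =>
      intro _ s hs
      have h1 := integral_der hx f.2 (k := p - 2) le_rfl h0 hs
      rw [show p - 2 + 1 = p - 1 by omega,
        integral_congr_knots (v := fun _ => 0) hx h0 hs htop, hf0 _ le_rfl] at h1
      simpa using h1.symm
    | succ j ih =>
      intro hj s hs
      have h1 := integral_der hx f.2 (k := p - 2 - (j + 1)) (by omega) h0 hs
      rw [show p - 2 - (j + 1) + 1 = p - 2 - j by omega, hf0 _ (by omega),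
        integral_congr_knots (v := fun _ => 0) hx h0 hs fun i s hs =>
          ih (by omega) s (Set.Ioo_subset_Icc_self (hx.Ioo_subset i hs))] at h1
      simpa using h1.symm
  ext t
  have := hall (p - 2) le_rfl t t.2
  rw [Nat.sub_self, der_zero, extend_coe] at this
  simpa using this

theorem finiteDimensional_splineSpace (hx : IsKnotVector x) (hp : 2 ≤ p) :
    FiniteDimensional ℝ (splineSpace p x) :=
  FiniteDimensional.of_injective _ (splineJet_injective hx hp)

/-- The jets have `(p - 1) + (K + 1)` coordinates. -/
theorem finrank_splineSpace_le (hx : IsKnotVector x) (hp : 2 ≤ p) :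
    Module.finrank ℝ (splineSpace p x) ≤ K + p := by
  refine (LinearMap.finrank_le_finrank_of_injective (splineJet_injective hx hp)).trans ?_
  simp
  omega

end Spline

/-! ### The Cox-de Boor recursion: derivatives, partition of unity, independence -/

/-- `t` runs through the points `x`, with repetitions only at `0` and `1`, starting at `0` and
reaching `1` at index `N`. -/
structure IsExtendedKnots {K : ℕ} (x : Fin (K + 2) → ℝ) (t : ℕ → ℝ) (N : ℕ) : Prop where
  monotone : Monotone t
  mem_range : ∀ j, t j ∈ Set.range x
  simple : ∀ j, t j = t (j + 1) → t j = 0 ∨ t j = 1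
  zero : t 0 = 0
  lt_one : ∀ j, j < N → t j < 1
  eq_one : ∀ j, N ≤ j → t j = 1

theorem isExtendedKnots_extKnot {K : ℕ} {x : Fin (K + 2) → ℝ} (hx : IsKnotVector x) {p : ℕ}
    (hp : 1 ≤ p) : IsExtendedKnots x (extKnot p x) (K + p) where
  monotone i j hij := hx.strictMono.monotone (by simp only [Fin.le_def]; omega)
  mem_range j := ⟨_, rfl⟩
  simple j h := by
    have := hx.strictMono.injective h
    rw [Fin.mk.injEq] at this
    -- Two neighbouring indices carry the same point only if the subtraction truncates both to `0`
    -- or the minimum cuts both off at `K + 1`.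
    rcases Nat.lt_or_ge j (p - 1) with h1 | h1
    · left
      rw [← hx.left]
      exact congr_arg x (Fin.ext (by simp; omega))
    · right
      rw [← hx.right]
      exact congr_arg x (Fin.ext (by simp; omega))
  zero := by
    rw [← hx.left]
    exact congr_arg x (Fin.ext (by simp))
  lt_one j hj := by
    rw [← hx.right]
    exact hx.strictMono (by simp only [Fin.lt_def, Fin.val_last]; omega)
  eq_one j hj := by
    rw [← hx.right]
    exact congr_arg x (Fin.ext (by simp; omega))

theorem deBoor_succ (t : ℕ → ℝ) (q j : ℕ) (s : ℝ) :
    deBoor t (q + 1) j s = (s - t j) / (t (j + q + 1) - t j) * deBoor t q j s +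
      (t (j + q + 2) - s) / (t (j + q + 2) - t (j + 1)) * deBoor t q (j + 1) s := by
  rw [deBoor]

theorem deBoor_zero_of_ne_one (t : ℕ → ℝ) (j : ℕ) {s : ℝ} (hs : s ≠ 1) :
    deBoor t 0 j s = if t j ≤ s ∧ s < t (j + 1) then 1 else 0 := by
  rw [deBoor]
  simp [hs]

/-- Order one has an empty interval; in higher order both denominators vanish, and the quotients are
zero by convention. -/
theorem deBoor_eq_zero {t : ℕ → ℝ} (ht : Monotone t) {q j : ℕ} (h : t j = t (j + q + 1)) (s : ℝ) :
    deBoor t q j s = 0 := by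
  cases q with
  | zero =>
    rw [deBoor, if_neg]
    rw [add_zero] at h
    rintro ⟨h1, h2 | ⟨-, h2, h3⟩⟩ <;> linarith
  | succ q =>
    have h1 : t j = t (j + q + 1) :=
      le_antisymm (ht (by omega)) (h ▸ ht (by omega))
    have h2 : t (j + 1) = t (j + q + 2) :=
      le_antisymm (ht (by omega)) ((h ▸ ht (by omega) : t (j + q + 2) ≤ t j).trans (ht (by omega)))
    rw [deBoor_succ, ← h1, ← h2]
    simp

theorem hasDerivAt_deBoor_zero (t : ℕ → ℝ) (j : ℕ) {s : ℝ} (hs1 : s ≠ 1) (hs : s ∉ Set.range t) :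
    HasDerivAt (deBoor t 0 j) 0 s := by
  refine (hasDerivAt_const s (deBoor t 0 j s)).congr_of_eventuallyEq ?_
  have hne : ∀ i, t i ≠ s := fun i h => hs ⟨i, h⟩
  have hside : ∀ i, ∀ᶠ y in 𝓝 s, (t i ≤ y ↔ t i ≤ s) := fun i => by
    rcases lt_or_gt_of_ne (hne i) with h | h
    · filter_upwards [lt_mem_nhds h] with y hy using iff_of_true hy.le h.le
    · filter_upwards [gt_mem_nhds h] with y hy using iff_of_false hy.not_ge h.not_ge
  filter_upwards [hside j, hside (j + 1), isOpen_ne.mem_nhds hs1] with y h1 h2 h3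
  rw [deBoor_zero_of_ne_one t j h3, deBoor_zero_of_ne_one t j hs1]
  simp only [h1, ← not_le, h2]

/-- The algebra of the induction step for the derivative formula, arranged to survive zero
denominators at repeated knots. The `X` and `Z` terms match outright; only the `Y` term needs a case
distinction. -/
theorem deBoor_derivative_identity {a b B C q X Y Z e₀ e₂ s : ℝ} (hab : a ≤ b)
    (hbB : b ≤ B) (hBC : B ≤ C) :
    (1 / (B - a) * ((s - a) / e₀ * X + (B - s) / (B - b) * Y)
        + (s - a) / (B - a) * (q * (X / e₀ - Y / (B - b))))
      + (-1 / (C - b) * ((s - b) / (B - b) * Y + (C - s) / e₂ * Z)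
        + (C - s) / (C - b) * (q * (Y / (B - b) - Z / e₂)))
      = (q + 1) * (((s - a) / e₀ * X + (B - s) / (B - b) * Y) / (B - a)
        - ((s - b) / (B - b) * Y + (C - s) / e₂ * Z) / (C - b)) := by
  -- If `b = B` the first factor is zero by convention; otherwise `a < B` and `b < C`, so both
  -- quotients are `1`.
  have key : Y / (B - b) * ((C - b) / (C - b) - (B - a) / (B - a)) = 0 := by
    rcases hbB.eq_or_lt with rfl | hlt
    · simp
    · rw [div_self (by linarith), div_self (by linarith), sub_self, mul_zero]
  linear_combination q * key

/-- The derivative of a B-spline away from the knots. -/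
theorem hasDerivAt_deBoor_succ {t : ℕ → ℝ} (ht : Monotone t) (q : ℕ) : ∀ (j : ℕ) {s : ℝ}, s ≠ 1 →
    s ∉ Set.range t → HasDerivAt (deBoor t (q + 1) j)
      ((q + 1) * (deBoor t q j s / (t (j + q + 1) - t j)
        - deBoor t q (j + 1) s / (t (j + q + 2) - t (j + 1)))) s := by
  induction q with
  | zero =>
    intro j s hs1 hs
    have h1 := (((hasDerivAt_id s).sub_const (t j)).div_const (t (j + 0 + 1) - t j)).mul
      (hasDerivAt_deBoor_zero t j hs1 hs)
    have h2 := (((hasDerivAt_id s).const_sub (t (j + 0 + 2))).div_const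
      (t (j + 0 + 2) - t (j + 1))).mul (hasDerivAt_deBoor_zero t (j + 1) hs1 hs)
    refine ((h1.add h2).congr_of_eventuallyEq
      (Eventually.of_forall fun y => deBoor_succ t 0 j y)).congr_deriv ?_
    simp only [Nat.cast_zero]
    ring
  | succ q ih =>
    intro j s hs1 hs
    have h1 := (((hasDerivAt_id s).sub_const (t j)).div_const (t (j + (q + 1) + 1) - t j)).mul
      (ih j hs1 hs)
    have h2 := (((hasDerivAt_id s).const_sub (t (j + (q + 1) + 2))).div_const
      (t (j + (q + 1) + 2) - t (j + 1))).mul (ih (j + 1) hs1 hs)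
    refine ((h1.add h2).congr_of_eventuallyEq
      (Eventually.of_forall fun y => deBoor_succ t (q + 1) j y)).congr_deriv ?_
    have hid := deBoor_derivative_identity (a := t j) (b := t (j + 1)) (B := t (j + (q + 1) + 1))
      (C := t (j + (q + 1) + 2)) (q := (q : ℝ) + 1) (X := deBoor t q j s)
      (Y := deBoor t q (j + 1) s) (Z := deBoor t q (j + 2) s) (e₀ := t (j + q + 1) - t j)
      (e₂ := t (j + 1 + q + 2) - t (j + 2)) (s := s) (ht (by omega)) (ht (by omega)) (ht (by omega))
    rw [deBoor_succ t q j, deBoor_succ t q (j + 1)]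
    simp only [id, show j + 1 + q + 1 = j + (q + 1) + 1 by ring,
      show j + 1 + q + 2 = j + (q + 1) + 2 by ring, show j + q + 2 = j + (q + 1) + 1 by ring,
      show j + 1 + 1 = j + 2 by ring] at hid ⊢
    push_cast
    linear_combination hid

section DeBoor

variable {K N : ℕ} {x : Fin (K + 2) → ℝ} {t : ℕ → ℝ}

theorem IsExtendedKnots.nonneg (ht : IsExtendedKnots x t N) (j : ℕ) : 0 ≤ t j :=
  ht.zero ▸ ht.monotone (Nat.zero_le j)

theorem IsExtendedKnots.le_one (ht : IsExtendedKnots x t N) (j : ℕ) : t j ≤ 1 := by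
  rcases Nat.lt_or_ge j N with h | h
  · exact (ht.lt_one j h).le
  · exact (ht.eq_one j h).le

theorem IsExtendedKnots.range_subset (ht : IsExtendedKnots x t N) : Set.range t ⊆ Set.range x :=
  Set.range_subset_iff.2 ht.mem_range

/-- Partition of unity. -/
theorem sum_deBoor (ht : IsExtendedKnots x t N) {s : ℝ} (hs : s ∈ Set.Ioo (0 : ℝ) 1) (q : ℕ)
    (hq : t q = 0) : ∑ j ∈ Finset.range N, deBoor t q j s = 1 := by
  induction q with
  | zero =>
    have h : ∀ j, deBoor t 0 j s = (if t j ≤ s then 1 else 0) - (if t (j + 1) ≤ s then 1 else 0) := by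
      intro j
      rw [deBoor_zero_of_ne_one t j hs.2.ne]
      have := ht.monotone (Nat.le_succ j)
      simp only [← not_le]
      by_cases h1 : t j ≤ s <;> by_cases h2 : t (j + 1) ≤ s <;> simp [h1, h2]
      exact h1 (this.trans h2)
    simp only [h]
    rw [Finset.sum_range_sub', ht.zero, ht.eq_one N le_rfl, if_pos hs.1.le, if_neg hs.2.not_ge,
      sub_zero]
  | succ q ih =>
    have hq' : t q = 0 := le_antisymm (hq ▸ ht.monotone (Nat.le_succ q)) (ht.nonneg q)
    -- The second summand of the recursion is `v (j + 1)`. As `v` vanishes at `0` and `N`, the shift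
    -- is harmless under the sum, and the two weights on each lower-order B-spline then add to one.
    set v : ℕ → ℝ := fun j => (t (j + q + 1) - s) / (t (j + q + 1) - t j) * deBoor t q j s with hv
    have h0 : v 0 = 0 := by simp [hv, ht.zero, hq]
    have hN : v N = 0 := by simp [hv, ht.eq_one (N + q + 1) (by omega), ht.eq_one N le_rfl]
    have hshift : ∑ j ∈ Finset.range N, v (j + 1) = ∑ j ∈ Finset.range N, v j := by
      have h1 := Finset.sum_range_succ v N
      rw [Finset.sum_range_succ', h0, hN, add_zero, add_zero] at h1
      exact h1
    have hsum : ∀ j, (s - t j) / (t (j + q + 1) - t j) * deBoor t q j s + v j = deBoor t q j s := by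
      intro j
      by_cases hd : t j = t (j + q + 1)
      · simp [hv, deBoor_eq_zero ht.monotone hd]
      · have : t (j + q + 1) - t j ≠ 0 := sub_ne_zero.2 (Ne.symm hd)
        simp only [hv]
        field_simp
        ring
    calc ∑ j ∈ Finset.range N, deBoor t (q + 1) j s
        = ∑ j ∈ Finset.range N,
            ((s - t j) / (t (j + q + 1) - t j) * deBoor t q j s + v (j + 1)) := by
          refine Finset.sum_congr rfl fun j _ => ?_
          rw [deBoor_succ]
          simp only [hv, show j + 1 + q + 1 = j + q + 2 by ring]
      _ = ∑ j ∈ Finset.range N, ((s - t j) / (t (j + q + 1) - t j) * deBoor t q j s + v j) := by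
          rw [Finset.sum_add_distrib, hshift, ← Finset.sum_add_distrib]
      _ = 1 := by simp only [hsum]; exact ih hq'

/-- Linear independence of the nontrivial B-splines. -/
theorem deBoor_coeff_eq_zero (ht : IsExtendedKnots x t N) (q : ℕ) : t q = 0 → ∀ c : ℕ → ℝ,
    (∀ s ∈ Set.Ioo (0 : ℝ) 1 \ Set.range t, ∑ j ∈ Finset.range N, c j * deBoor t q j s = 0) →
    ∀ j, j < N → t j < t (j + q + 1) → c j = 0 := by
  induction q with
  | zero =>
    intro _ c hc j hj hlt
    rw [add_zero] at hlt
    set s := (t j + t (j + 1)) / 2 with hs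
    have hs1 : t j < s := left_lt_add_div_two.2 hlt
    have hs2 : s < t (j + 1) := add_div_two_lt_right.2 hlt
    have hsI : s ∈ Set.Ioo (0 : ℝ) 1 :=
      ⟨(ht.nonneg j).trans_lt hs1, hs2.trans_le (ht.le_one _)⟩
    have hsr : s ∉ Set.range t := by
      rintro ⟨i, hi⟩
      rcases Nat.lt_or_ge j i with h | h
      · exact absurd (hi ▸ hs2) (ht.monotone h).not_gt
      · exact absurd (hi ▸ hs1) (ht.monotone h).not_gt
    have h := hc s ⟨hsI, hsr⟩
    rw [Finset.sum_eq_single j] at h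
    · rwa [deBoor_zero_of_ne_one t j hsI.2.ne, if_pos ⟨hs1.le, hs2⟩, mul_one] at h
    · intro i _ hij
      rw [deBoor_zero_of_ne_one t i hsI.2.ne, if_neg, mul_zero]
      rintro ⟨h1, h2⟩
      rcases Nat.lt_or_gt_of_ne hij with h | h
      · exact absurd (h2.trans_le (ht.monotone h)) hs1.le.not_gt
      · exact absurd (hs2.trans_le (ht.monotone h)) h1.not_gt
    · intro h
      exact absurd (Finset.mem_range.2 hj) h
  | succ q ih =>
    intro hq c hc j hj hlt
    have hq' : t q = 0 := le_antisymm (hq ▸ ht.monotone (Nat.le_succ q)) (ht.nonneg q)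
    have hfin : (Set.range t).Finite := (Set.finite_range x).subset ht.range_subset
    have hopen : IsOpen (Set.Ioo (0 : ℝ) 1 \ Set.range t) :=
      isOpen_Ioo.sdiff hfin.isClosed
    -- Differentiate the relation and sum by parts. The truncated `c (0 - 1)` does no harm, since
    -- the B-spline of index `0` is trivial at this lower order.
    have hdiff : ∀ s ∈ Set.Ioo (0 : ℝ) 1 \ Set.range t, ∑ j ∈ Finset.range N,
        ((c j - c (j - 1)) / (t (j + q + 1) - t j)) * deBoor t q j s = 0 := by
      intro s hs
      set E : ℕ → ℝ := fun j => deBoor t q j s / (t (j + q + 1) - t j) with hE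
      have hE0 : E 0 = 0 := by simp [hE, ht.zero, hq]
      have hEN : E N = 0 := by
        simp [hE, ht.eq_one (N + q + 1) (by omega), ht.eq_one N le_rfl]
      have hd : HasDerivAt (fun y => ∑ j ∈ Finset.range N, c j * deBoor t (q + 1) j y)
          (∑ j ∈ Finset.range N, c j * ((q + 1) * (E j - E (j + 1)))) s := by
        refine HasDerivAt.fun_sum fun j _ => ?_
        have := (hasDerivAt_deBoor_succ ht.monotone q j hs.1.2.ne hs.2).const_mul (c j)
        simpa only [hE, show j + 1 + q + 1 = j + q + 2 by ring] using this
      have hd0 : HasDerivAt (fun y => ∑ j ∈ Finset.range N, c j * deBoor t (q + 1) j y) 0 s := by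
        refine (hasDerivAt_const s (0 : ℝ)).congr_of_eventuallyEq ?_
        filter_upwards [hopen.mem_nhds hs] with y hy using hc y hy
      have h1 := hd.unique hd0
      have h2 : ∑ j ∈ Finset.range N, c j * E (j + 1) = ∑ j ∈ Finset.range N, c (j - 1) * E j := by
        have := Finset.sum_range_succ (fun j => c (j - 1) * E j) N
        rw [Finset.sum_range_succ', hE0, hEN] at this
        simpa using this
      have h3 : ∑ j ∈ Finset.range N, c j * ((q + 1) * (E j - E (j + 1)))
          = (q + 1) * (∑ j ∈ Finset.range N, c j * E j - ∑ j ∈ Finset.range N, c j * E (j + 1)) := by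
        rw [← Finset.sum_sub_distrib, Finset.mul_sum]
        exact Finset.sum_congr rfl fun j _ => by ring
      rw [h3, h2, ← Finset.sum_sub_distrib] at h1
      have h4 := (mul_eq_zero.1 h1).resolve_left (by positivity)
      rw [← h4]
      exact Finset.sum_congr rfl fun j _ => by simp only [hE]; ring
    -- By induction consecutive coefficients agree. The next lower-order support cannot be
    -- degenerate: that would repeat a knot below `1`, hence `0`, forcing `t (i + q + 2) = 0`.
    have hstep : ∀ i, i + 1 < N → t i < t (i + q + 2) →
        t (i + 1) < t (i + q + 2) ∧ c (i + 1) = c i := by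
      intro i hi hlt
      have h1 : t (i + 1) < t (i + q + 2) := by
        refine lt_of_le_of_ne (ht.monotone (by omega)) fun h => ?_
        have h2 : t (i + 1) = t (i + 2) :=
          le_antisymm (ht.monotone (by omega)) (h ▸ ht.monotone (by omega))
        have h3 := (ht.simple _ h2).resolve_right (ht.lt_one _ hi).ne
        have := ht.nonneg i
        linarith
      refine ⟨h1, ?_⟩
      have h2 := ih hq' _ hdiff (i + 1) hi (by rwa [show i + 1 + q + 1 = i + q + 2 by ring])
      rw [show i + 1 + q + 1 = i + q + 2 by ring] at h2
      have h3 := (div_eq_zero_iff.1 h2).resolve_right (sub_ne_zero.2 h1.ne')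
      simpa [sub_eq_zero] using h3
    have hconst : ∀ k i, i + k + 1 = N → t i < t (i + q + 2) → c i = c (N - 1) := by
      intro k
      induction k with
      | zero =>
        intro i hi _
        congr 1
        omega
      | succ k ihk =>
        intro i hi hlt
        obtain ⟨h1, h2⟩ := hstep i (by omega) hlt
        rw [← h2]
        exact ihk (i + 1) (by omega) (h1.trans_le (ht.monotone (by omega)))
    -- Trivial B-splines vanish, so all coefficients may be replaced by the common value `c (N -
    -- 1)`; partition of unity at one point shows it is zero.
    obtain ⟨s, hs⟩ := ((Set.Ioo_infinite (zero_lt_one' ℝ)).sdiff hfin).nonempty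
    have hsum := hc s hs
    have heq : ∑ j ∈ Finset.range N, c j * deBoor t (q + 1) j s
        = c (N - 1) * ∑ j ∈ Finset.range N, deBoor t (q + 1) j s := by
      rw [Finset.mul_sum]
      refine Finset.sum_congr rfl fun i hi => ?_
      rcases (ht.monotone (by omega : i ≤ i + (q + 1) + 1)).eq_or_lt with h | h
      · rw [deBoor_eq_zero ht.monotone h, mul_zero, mul_zero]
      · have := Finset.mem_range.1 hi
        rw [hconst (N - 1 - i) i (by omega) h]
    rw [heq, sum_deBoor ht hs.1 _ hq, mul_one] at hsum
    rw [hconst (N - 1 - j) j (by omega) hlt, hsum]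

end DeBoor

/-! ### B-splines are splines -/

section Smoothness

variable {K N p : ℕ} {x : Fin (K + 2) → ℝ} {t : ℕ → ℝ}

/-- A continuous function whose derivative between the knots is a continuous function `G` is
differentiable with derivative `G`. -/
theorem hasDerivWithinAt_of_off_knots (hx : IsKnotVector x) {f G : ℝ → ℝ}
    (hf : ContinuousOn f (Set.Icc 0 1)) (hG : Continuous G)
    (h : ∀ i : Fin (K + 1), ∀ s ∈ Set.Ioo (x i.castSucc) (x i.succ), HasDerivAt f (G s) s)
    {s : ℝ} (hs : s ∈ Set.Icc (0 : ℝ) 1) : HasDerivWithinAt f (G s) (Set.Icc 0 1) s := by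
  have hint : ∀ s ∈ Set.Icc (0 : ℝ) 1, f s = f 0 + ∫ y in (0 : ℝ)..s, G y := fun s hs => by
    rw [MeasureTheory.integral_eq_of_hasDerivAt_off_countable_of_le f G hs.1
      (Set.finite_range x).countable (hf.mono (Set.Icc_subset_Icc_right hs.2)) (fun y hy => ?_)
      (hG.intervalIntegrable _ _)]
    · ring
    · obtain ⟨i, hi⟩ := hx.exists_mem_Ioo ⟨hy.1.1, hy.1.2.trans_le hs.2⟩ hy.2
      exact h i y hi
  have hd : HasDerivAt (fun s => f 0 + ∫ y in (0 : ℝ)..s, G y) (G s) s :=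
    (hG.integral_hasStrictDerivAt 0 s).hasDerivAt.const_add _
  exact hd.hasDerivWithinAt.congr hint (hint s hs)

theorem continuous_extend {g : I → ℝ} (hg : g ∈ splineSpace p x) : Continuous (extend g) := by
  refine Continuous.Icc_extend' ?_
  have h := continuousOn_iff_continuous_domRestrict.1 (continuousOn_extend hg)
  exact h.congr fun t => extend_coe g t

/-- Being an antiderivative of `g`, `f` gains one degree of smoothness over it; this drives the
induction on the order. -/
theorem contDiffOn_succ_of_off_knots (hx : IsKnotVector x) {f : ℝ → ℝ} {g : I → ℝ}
    (hf : ContinuousOn f (Set.Icc 0 1)) (hg : g ∈ splineSpace (p + 2) x)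
    (h : ∀ i : Fin (K + 1), ∀ s ∈ Set.Ioo (x i.castSucc) (x i.succ),
      HasDerivAt f (extend g s) s) :
    ContDiffOn ℝ ((p + 1 : ℕ) : WithTop ℕ∞) f (Set.Icc 0 1) := by
  have hd : ∀ s ∈ Set.Icc (0 : ℝ) 1, HasDerivWithinAt f (extend g s) (Set.Icc 0 1) s :=
    fun s hs => hasDerivWithinAt_of_off_knots hx hf (continuous_extend hg) h hs
  have h1 := contDiffOn_extend hg
  rw [Nat.add_sub_cancel] at h1
  rw [Nat.cast_add, Nat.cast_one, contDiffOn_succ_iff_derivWithin uniqueDiffOn_Icc_zero_one]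
  refine ⟨fun s hs => (hd s hs).differentiableWithinAt, by simp, h1.congr fun s hs => ?_⟩
  exact (hd s hs).derivWithin (uniqueDiffOn_Icc_zero_one s hs)

/-- B-splines of order two are continuous on `[0,1]`. -/
theorem continuousOn_deBoor_one (ht : IsExtendedKnots x t N) (j : ℕ) :
    ContinuousOn (deBoor t 1 j) (Set.Icc 0 1) := by
  have hab := ht.monotone (Nat.le_succ j)
  have hbc := ht.monotone (Nat.le_succ (j + 1))
  have hs1 := ht.simple j
  have hs2 := ht.simple (j + 1)
  have ha0 := ht.nonneg j
  have hc1 := ht.le_one (j + 2)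
  simp only [Nat.succ_eq_add_one, show j + 1 + 1 = j + 2 by ring] at hab hbc hs2
  have hrec : ∀ s, deBoor t 1 j s = (s - t j) / (t (j + 1) - t j) * deBoor t 0 j s +
      (t (j + 2) - s) / (t (j + 2) - t (j + 1)) * deBoor t 0 (j + 1) s := deBoor_succ t 0 j
  have hB0 : ∀ s, deBoor t 0 j s = if t j ≤ s ∧ (s < t (j + 1) ∨ (s = 1 ∧ t j < 1 ∧ t (j + 1) = 1))
      then 1 else 0 := fun s => by rw [deBoor]
  have hB1 : ∀ s, deBoor t 0 (j + 1) s =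
      if t (j + 1) ≤ s ∧ (s < t (j + 2) ∨ (s = 1 ∧ t (j + 1) < 1 ∧ t (j + 2) = 1))
      then 1 else 0 := fun s => by rw [deBoor]
  simp only [hB0, hB1] at hrec
  clear hB0 hB1
  generalize t j = a at *
  generalize t (j + 1) = b at *
  generalize t (j + 2) = c at *
  -- A double knot sits at `0` or `1`, so the missing side of the hat lies outside `[0,1]`. Each
  -- case compares with an explicit continuous function: zero, a clamped ramp, or two ramps glued at
  -- `b`.
  rcases hab.eq_or_lt with rfl | hab
  · rcases hbc.eq_or_lt with rfl | hbc
    · refine continuousOn_const (c := (0 : ℝ)) |>.congr fun s _ => ?_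
      rw [hrec]
      simp
    · have : ContinuousOn (fun s => max 0 ((c - s) / (c - a))) (Set.Icc 0 1) := by fun_prop
      refine this.congr fun s hs => ?_
      have ha : a = 0 := (hs1 rfl).resolve_right (by linarith)
      subst ha
      rw [hrec]
      simp only [sub_zero, sub_self, div_zero, zero_mul, zero_add]
      rcases lt_or_ge s c with h | h
      · rw [if_pos ⟨hs.1, Or.inl h⟩, mul_one, max_eq_right]
        exact div_nonneg (by linarith) hbc.le
      · rw [max_eq_left (div_nonpos_of_nonpos_of_nonneg (by linarith) hbc.le)]
        split_ifs with h'
        · have : s = c := by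
            rcases h'.2 with h2 | ⟨h2, -, h3⟩ <;> linarith
          simp [this]
        · simp
  · rcases hbc.eq_or_lt with rfl | hbc
    · have hb : b = 1 := (hs2 rfl).resolve_left (by linarith)
      subst hb
      have : ContinuousOn (fun s => max 0 ((s - a) / (1 - a))) (Set.Icc 0 1) := by fun_prop
      refine this.congr fun s hs => ?_
      rw [hrec]
      simp only [sub_self, div_zero, zero_mul, add_zero]
      rcases lt_or_ge s a with h | h
      · rw [if_neg (fun h' => absurd h'.1 h.not_ge), mul_zero, max_eq_left]
        exact div_nonpos_of_nonpos_of_nonneg (by linarith) (by linarith)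
      · have h' : s < 1 ∨ (s = 1 ∧ a < 1 ∧ True) :=
          hs.2.eq_or_lt.elim (fun h1 => Or.inr ⟨h1, hab, trivial⟩) Or.inl
        rw [if_pos ⟨h, h'⟩, mul_one, max_eq_right]
        exact div_nonneg (by linarith) (by linarith)
    · have : ContinuousOn (fun s => if s ≤ b then max 0 ((s - a) / (b - a))
          else max 0 ((c - s) / (c - b))) (Set.Icc 0 1) := by
        refine Continuous.continuousOn (Continuous.if_le (by fun_prop) (by fun_prop)
          continuous_id continuous_const fun s hs => ?_)
        rw [show s = b from hs, div_self (by linarith), div_self (by linarith)]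
      refine this.congr fun s hs => ?_
      rw [hrec]
      have hb1 : b ≠ 1 := by linarith
      simp only [hb1, and_false, or_false]
      have hba : b - a ≠ 0 := by linarith
      have hcb : c - b ≠ 0 := by linarith
      rcases lt_trichotomy s b with h | h | h
      · rw [if_pos h.le, if_neg (fun h' : b ≤ s ∧ _ => absurd h'.1 h.not_ge)]
        rcases lt_or_ge s a with h2 | h2
        · rw [if_neg (fun h' : a ≤ s ∧ _ => absurd h'.1 h2.not_ge), max_eq_left
            (div_nonpos_of_nonpos_of_nonneg (by linarith) (by linarith))]
          simp
        · rw [if_pos ⟨h2, h⟩, max_eq_right (div_nonneg (by linarith) (by linarith))]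
          simp
      · subst h
        rw [if_neg (fun h' => absurd h'.2 (lt_irrefl _)), if_pos ⟨le_rfl, Or.inl hbc⟩,
          if_pos le_rfl, div_self hba, div_self hcb]
        simp
      · rw [if_neg h.not_ge, if_neg (fun h' : a ≤ s ∧ _ => absurd h'.2 h.not_gt)]
        rcases lt_or_ge s c with h2 | h2
        · rw [if_pos ⟨h.le, Or.inl h2⟩, max_eq_right (div_nonneg (by linarith) (by linarith))]
          simp
        · rw [max_eq_left (div_nonpos_of_nonpos_of_nonneg (by linarith) (by linarith))]
          split_ifs with h'
          · have : s = c := by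
              rcases h'.2 with h2 | ⟨h2, -, h3⟩ <;> linarith
            simp [this]
          · simp

theorem continuousOn_deBoor (ht : IsExtendedKnots x t N) (q j : ℕ) :
    ContinuousOn (deBoor t (q + 1) j) (Set.Icc 0 1) := by
  induction q generalizing j with
  | zero => exact continuousOn_deBoor_one ht j
  | succ q ih =>
    have h1 := ih j
    have h2 := ih (j + 1)
    have : ContinuousOn (fun s => (s - t j) / (t (j + (q + 1) + 1) - t j) * deBoor t (q + 1) j s +
      (t (j + (q + 1) + 2) - s) / (t (j + (q + 1) + 2) - t (j + 1))
        * deBoor t (q + 1) (j + 1) s) (Set.Icc 0 1) :=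
      ((by fun_prop : ContinuousOn (fun s => (s - t j) / (t (j + (q + 1) + 1) - t j))
        (Set.Icc 0 1)).mul h1).add ((by fun_prop : ContinuousOn
        (fun s => (t (j + (q + 1) + 2) - s) / (t (j + (q + 1) + 2) - t (j + 1)))
        (Set.Icc 0 1)).mul h2)
    exact this.congr fun s _ => deBoor_succ t (q + 1) j s

theorem exists_polynomial_deBoor (hx : IsKnotVector x) (ht : IsExtendedKnots x t N) (q : ℕ)
    (i : Fin (K + 1)) (j : ℕ) : ∃ P : Polynomial ℝ, P.degree < ((q + 1 : ℕ) : WithBot ℕ) ∧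
      ∀ s ∈ Set.Ioo (x i.castSucc) (x i.succ), deBoor t q j s = P.eval s := by
  induction q generalizing j with
  | zero =>
    refine ⟨Polynomial.C (if t j ≤ x i.castSucc ∧ x i.castSucc < t (j + 1) then 1 else 0),
      Polynomial.degree_C_le.trans_lt (by norm_num), fun s hs => ?_⟩
    -- No knot lies inside the interval, so each comparison can be read off at its left end.
    have h : ∀ k, t k ≤ s ↔ t k ≤ x i.castSucc := fun k => by
      obtain ⟨l, hl⟩ := ht.mem_range k
      rw [← hl]
      refine ⟨fun h => ?_, fun h => h.trans hs.1.le⟩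
      have h1 := hx.strictMono.lt_iff_lt.1 (h.trans_lt hs.2)
      exact hx.strictMono.monotone (Fin.le_castSucc_iff.2 h1)
    rw [deBoor_zero_of_ne_one t j (hx.Ioo_subset i hs).2.ne, Polynomial.eval_C]
    simp only [← not_le, h]
  | succ q ih =>
    obtain ⟨P, hPd, hP⟩ := ih j
    obtain ⟨Q, hQd, hQ⟩ := ih (j + 1)
    have hdeg : ∀ (u v : ℝ) (R : Polynomial ℝ), R.degree < ((q + 1 : ℕ) : WithBot ℕ) →
        ((Polynomial.C u * Polynomial.X + Polynomial.C v) * R).degree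
          < ((q + 1 + 1 : ℕ) : WithBot ℕ) := fun u v R hR => by
      rcases eq_or_ne R 0 with rfl | hR0
      · rw [mul_zero, Polynomial.degree_zero]
        exact WithBot.bot_lt_coe _
      · have h1 := (Polynomial.natDegree_lt_iff_degree_lt hR0).2 hR
        have h2 := Polynomial.natDegree_mul_le
          (p := Polynomial.C u * Polynomial.X + Polynomial.C v) (q := R)
        have h3 := Polynomial.natDegree_linear_le (a := u) (b := v)
        refine Polynomial.degree_le_natDegree.trans_lt ?_
        exact_mod_cast (by omega : ((Polynomial.C u * Polynomial.X + Polynomial.C v) * R).natDegree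
          < q + 1 + 1)
    refine ⟨(Polynomial.C (t (j + q + 1) - t j)⁻¹ * Polynomial.X
        + Polynomial.C (-t j / (t (j + q + 1) - t j))) * P
      + (Polynomial.C (-(t (j + q + 2) - t (j + 1))⁻¹) * Polynomial.X
        + Polynomial.C (t (j + q + 2) / (t (j + q + 2) - t (j + 1)))) * Q,
      (Polynomial.degree_add_le _ _).trans_lt (max_lt (hdeg _ _ _ hPd) (hdeg _ _ _ hQd)),
      fun s hs => ?_⟩
    rw [deBoor_succ, hP s hs, hQ s hs]
    simp only [Polynomial.eval_add, Polynomial.eval_mul, Polynomial.eval_C, Polynomial.eval_X]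
    ring

/-- From order two on, continuity carries the polynomial identity to the closed interval. -/
theorem exists_polynomial_deBoor_Icc (hx : IsKnotVector x) (ht : IsExtendedKnots x t N) (q : ℕ)
    (i : Fin (K + 1)) (j : ℕ) : ∃ P : Polynomial ℝ, P.degree < ((q + 1 + 1 : ℕ) : WithBot ℕ) ∧
      ∀ s ∈ Set.Icc (x i.castSucc) (x i.succ), deBoor t (q + 1) j s = P.eval s := by
  obtain ⟨P, hPd, hP⟩ := exists_polynomial_deBoor hx ht (q + 1) i j
  refine ⟨P, hPd, Set.EqOn.of_subset_closure hP
    ((continuousOn_deBoor ht q j).mono (hx.Icc_subset i)) P.continuous.continuousOn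
    Set.Ioo_subset_Icc_self ?_⟩
  rw [closure_Ioo (hx.castSucc_lt_succ i).ne]

theorem deBoor_mem_splineSpace (hx : IsKnotVector x) (ht : IsExtendedKnots x t N) (q j : ℕ) :
    (fun s : I => deBoor t (q + 1) j s) ∈ splineSpace (q + 2) x := by
  have hext : ∀ (q j : ℕ), ∀ s ∈ Set.Icc (0 : ℝ) 1,
      extend (fun s : I => deBoor t q j s) s = deBoor t q j s := fun q j s hs =>
    extend_apply _ hs
  have hcont : ∀ q j : ℕ, ContinuousOn (extend fun s : I => deBoor t (q + 1) j s) (Set.Icc 0 1) :=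
    fun q j => (continuousOn_deBoor ht q j).congr (hext (q + 1) j)
  refine ⟨?_, fun i => ?_⟩
  · rw [Nat.add_sub_cancel]
    induction q generalizing j with
    | zero => exact contDiffOn_zero.2 (hcont 0 j)
    | succ q ih =>
      have hmem : ∀ j, (fun s : I => deBoor t (q + 1) j s) ∈ splineSpace (q + 2) x := fun j =>
        ⟨by rw [Nat.add_sub_cancel]; exact ih j, fun i => by
          obtain ⟨P, hPd, hP⟩ := exists_polynomial_deBoor_Icc hx ht q i j
          exact ⟨P, hPd, fun s hs => hP s hs⟩⟩
      -- The derivative formula read as a spline of one order less.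
      set g : I → ℝ := (((q + 1 : ℕ) : ℝ) + 1) • ((t (j + (q + 1) + 1) - t j)⁻¹ •
          (fun s : I => deBoor t (q + 1) j s)
        - (t (j + (q + 1) + 2) - t (j + 1))⁻¹ • fun s : I => deBoor t (q + 1) (j + 1) s) with hg
      have hgm : g ∈ splineSpace (q + 2) x :=
        Submodule.smul_mem _ _ (Submodule.sub_mem _ (Submodule.smul_mem _ _ (hmem j))
          (Submodule.smul_mem _ _ (hmem (j + 1))))
      refine contDiffOn_succ_of_off_knots hx (hcont (q + 1) j) hgm fun i s hs => ?_
      have hsI := hx.Ioo_subset i hs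
      have hd := hasDerivAt_deBoor_succ ht.monotone (q + 1) j hsI.2.ne
        (fun h => hx.notMem_range hs (ht.range_subset h))
      refine (hd.congr_of_eventuallyEq ?_).congr_deriv ?_
      · filter_upwards [isOpen_Ioo.mem_nhds hsI] with y hy
        exact hext _ _ y (Set.Ioo_subset_Icc_self hy)
      · rw [extend_apply g (Set.Ioo_subset_Icc_self hsI)]
        simp only [hg, Pi.smul_apply, Pi.sub_apply, smul_eq_mul]
        ring
  · obtain ⟨P, hPd, hP⟩ := exists_polynomial_deBoor_Icc hx ht q i j
    exact ⟨P, hPd, fun s hs => hP s hs⟩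

end Smoothness

/-! ### The B-spline basis and reproducing kernels in finite dimension -/

section Basis

variable {K p : ℕ} {x : Fin (K + 2) → ℝ}

theorem bspline_mem (hx : IsKnotVector x) (hp : 2 ≤ p) (j : Fin (K + p)) :
    bspline p x j ∈ splineSpace p x := by
  obtain ⟨q, rfl⟩ := Nat.exists_eq_add_of_le' hp
  exact deBoor_mem_splineSpace hx (isExtendedKnots_extKnot hx (by omega)) q j

theorem linearIndependent_bspline (hx : IsKnotVector x) (hp : 2 ≤ p) :
    LinearIndependent ℝ (bspline p x) := by
  rw [Fintype.linearIndependent_iff]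
  intro c hc j
  have ht := isExtendedKnots_extKnot hx (p := p) (by omega)
  have h := deBoor_coeff_eq_zero ht (p - 1)
    (by rw [← hx.left]; exact congr_arg x (Fin.ext (by simp)))
    (fun i => if hi : i < K + p then c ⟨i, hi⟩ else 0) (fun s hs => ?_) j j.2 ?_
  · simpa using h
  · have h1 := congr_fun hc ⟨s, Set.Ioo_subset_Icc_self hs.1⟩
    rw [Finset.sum_range]
    simpa [bspline] using h1
  -- No B-spline of the full order is trivial: `p` steps in the extended sequence always pass to a
  -- larger point when `j < K + p`.
  · refine hx.strictMono ?_
    simp only [Fin.lt_def]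
    have := j.2
    omega

/-- The B-splines as a basis of the spline space. -/
noncomputable def bsplineBasis (hx : IsKnotVector x) (hp : 2 ≤ p) :
    Module.Basis (Fin (K + p)) ℝ (splineSpace p x) :=
  haveI := finiteDimensional_splineSpace hx hp
  have hli : LinearIndependent ℝ
      fun j : Fin (K + p) => (⟨bspline p x j, bspline_mem hx hp j⟩ : splineSpace p x) :=
    LinearIndependent.of_comp (splineSpace p x).subtype (linearIndependent_bspline hx hp)
  have : Nonempty (Fin (K + p)) := ⟨⟨0, by omega⟩⟩
  basisOfLinearIndependentOfCardEqFinrank hli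
    (le_antisymm hli.fintype_card_le_finrank
      (by rw [Fintype.card_fin]; exact finrank_splineSpace_le hx hp))

theorem coe_bsplineBasis (hx : IsKnotVector x) (hp : 2 ≤ p) (j : Fin (K + p)) :
    (bsplineBasis hx hp j : I → ℝ) = bspline p x j := by
  simp [bsplineBasis]

end Basis

/-- A finite-dimensional space of functions with a positive definite symmetric form `B` and a
reproducing function `k` is a reproducing kernel Hilbert space. -/
theorem isRKHSWithKernel_of_finiteDimensional {X E : Type} [AddCommGroup E] [Module ℝ E]
    [FiniteDimensional ℝ E] (φ : E →ₗ[ℝ] X → ℝ) (hφ : Function.Injective φ)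
    (ip : (X → ℝ) → (X → ℝ) → ℝ) (k : X → X → ℝ)
    (B : E →ₗ[ℝ] E →ₗ[ℝ] ℝ) (hB : ∀ f g, B f g = ip (φ f) (φ g)) (hsymm : ∀ f g, B f g = B g f)
    (hnonneg : ∀ f, 0 ≤ B f f) (hdef : ∀ f, B f f = 0 → f = 0)
    (hk : ∀ z, (fun y => k y z) ∈ LinearMap.range φ)
    (hrep : ∀ f z, φ f z = ip (fun y => k y z) (φ f)) :
    IsRKHSWithKernel (LinearMap.range φ) ip k := by
  let core : InnerProductSpace.Core ℝ E :=
    { inner := fun f g => B f g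
      conj_inner_symm := fun f g => hsymm g f
      re_inner_nonneg := fun f => hnonneg f
      add_left := fun f g h => by rw [map_add]; rfl
      smul_left := fun f g r => by rw [map_smul]; rfl
      definite := fun f h => hdef f h }
  let nacg : NormedAddCommGroup E := core.toNormedAddCommGroup
  let ips : InnerProductSpace ℝ E := InnerProductSpace.ofCore core.toCore
  have hinner : ∀ f g : E, inner ℝ f g = B f g := fun f g => rfl
  have hcomplete : CompleteSpace E := FiniteDimensional.complete ℝ E
  -- Evaluations are continuous because every linear map on a finite-dimensional space is.
  let rk : RKHS ℝ E X ℝ :=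
    { coeCLM := LinearMap.toContinuousLinearMap φ
      coeCLM_injective := hφ }
  have hcoe : ∀ f : E, (f : X → ℝ) = φ f := fun f => rfl
  refine ⟨E, nacg, ips, hcomplete, rk, rfl, fun f g => hB f g, fun y z => ?_⟩
  obtain ⟨g, hg⟩ := hk z
  have h1 : RKHS.kerFun E z (1 : ℝ) = g := by
    refine ext_inner_right ℝ fun f => ?_
    rw [RKHS.kerFun_inner, hinner, hB, hg, ← hrep f z, hcoe]
    simp
  rw [← RKHS.kerFun_apply, h1, hcoe, hg]

/-! ### The penalized Gram matrix and the spline kernel -/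

section Kernel

variable {K m p : ℕ} {x : Fin (K + 2) → ℝ} {lam : ℝ}

theorem penGram_apply (i j : Fin (K + p)) :
    penGram m p lam x i j = penInner m lam (bspline p x i) (bspline p x j) :=
  rfl

theorem penGram_transpose : (penGram m p lam x)ᵀ = penGram m p lam x := by
  ext i j
  rw [Matrix.transpose_apply, penGram_apply, penGram_apply, penInner_comm]

theorem penInner_sum_bspline (hx : IsKnotVector x) (hp : 2 ≤ p) (c d : Fin (K + p) → ℝ) :
    penInner m lam (∑ i, c i • bspline p x i) (∑ j, d j • bspline p x j)
      = c ⬝ᵥ (penGram m p lam x *ᵥ d) := by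
  have h : ∀ c : Fin (K + p) → ℝ, ∑ i, c i • bspline p x i
      = ((∑ i, c i • bsplineBasis hx hp i : splineSpace p x) : I → ℝ) := fun c => by
    simp [coe_bsplineBasis]
  rw [h c, h d, ← penForm_apply hx]
  simp only [map_sum, map_smul, LinearMap.sum_apply, LinearMap.smul_apply, penForm_apply,
    coe_bsplineBasis, ← penGram_apply, dotProduct, Matrix.mulVec, smul_eq_mul]
  simp only [Finset.mul_sum]
  rw [Finset.sum_comm]
  exact Finset.sum_congr rfl fun i _ => Finset.sum_congr rfl fun j _ => by ring

theorem exists_coeff_of_mem (hx : IsKnotVector x) (hp : 2 ≤ p) {f : I → ℝ}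
    (hf : f ∈ splineSpace p x) : ∃ c : Fin (K + p) → ℝ, f = ∑ i, c i • bspline p x i := by
  refine ⟨(bsplineBasis hx hp).repr ⟨f, hf⟩, ?_⟩
  have h := congr_arg (splineSpace p x).subtype ((bsplineBasis hx hp).sum_repr ⟨f, hf⟩)
  simp only [map_sum, map_smul, Submodule.subtype_apply, coe_bsplineBasis] at h
  exact h.symm

/-- A null vector of the matrix gives a spline of zero norm, hence the zero spline, and independence
makes its coefficients zero. -/
theorem isUnit_det_penGram (hx : IsKnotVector x) (hp : 2 ≤ p) (hlam : 0 ≤ lam) :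
    IsUnit (penGram m p lam x).det := by
  rw [← Matrix.isUnit_iff_isUnit_det, ← Matrix.mulVec_injective_iff_isUnit]
  refine (injective_iff_map_eq_zero (penGram m p lam x).mulVecLin).2 fun c hc => ?_
  rw [Matrix.mulVecLin_apply] at hc
  have h0 := penInner_sum_bspline (m := m) (lam := lam) hx hp c c
  rw [hc, dotProduct_zero] at h0
  have h1 := eq_zero_of_penInner_self_eq_zero (Submodule.sum_mem _ fun i _ =>
    Submodule.smul_mem _ _ (bspline_mem hx hp i)) hlam h0
  exact funext (Fintype.linearIndependent_iff.1 (linearIndependent_bspline hx hp) c h1)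

theorem splineKernel_comm (s t : I) :
    splineKernel m p lam x s t = splineKernel m p lam x t s := by
  unfold splineKernel
  rw [Matrix.dotProduct_mulVec, ← Matrix.mulVec_transpose, Matrix.transpose_nonsing_inv,
    penGram_transpose, dotProduct_comm]

theorem splineKernel_eq_sum (t : I) : (fun s => splineKernel m p lam x s t)
    = ∑ i, ((penGram m p lam x)⁻¹ *ᵥ fun j => bspline p x j t) i • bspline p x i := by
  funext s
  simp only [splineKernel, dotProduct, Finset.sum_apply, Pi.smul_apply, smul_eq_mul]
  exact Finset.sum_congr rfl fun i _ => mul_comm _ _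

theorem splineKernel_mem (hx : IsKnotVector x) (hp : 2 ≤ p) (t : I) :
    (fun s => splineKernel m p lam x s t) ∈ splineSpace p x := by
  rw [splineKernel_eq_sum]
  exact Submodule.sum_mem _ fun i _ => Submodule.smul_mem _ _ (bspline_mem hx hp i)

/-- If `f` has coefficients `c`, pairing it with the spline of coefficients `G⁻¹ B(t)` gives `cᵀ G
G⁻¹ B(t) = cᵀ B(t) = f(t)`. -/
theorem penInner_splineKernel (hx : IsKnotVector x) (hp : 2 ≤ p) (hlam : 0 ≤ lam) {f : I → ℝ}
    (hf : f ∈ splineSpace p x) (t : I) :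
    f t = penInner m lam (fun s => splineKernel m p lam x s t) f := by
  obtain ⟨c, rfl⟩ := exists_coeff_of_mem hx hp hf
  rw [splineKernel_eq_sum, penInner_comm, penInner_sum_bspline hx hp, Matrix.mulVec_mulVec,
    Matrix.mul_nonsing_inv _ (isUnit_det_penGram hx hp hlam), Matrix.one_mulVec]
  simp [dotProduct]

theorem isRKHSWithKernel_splineSpace (hx : IsKnotVector x) (hp : 2 ≤ p) (hlam : 0 ≤ lam) :
    IsRKHSWithKernel (splineSpace p x) (penInner m lam) (splineKernel m p lam x) := by
  have := finiteDimensional_splineSpace hx hp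
  have h := isRKHSWithKernel_of_finiteDimensional (splineSpace p x).subtype
    Subtype.val_injective (penInner m lam) (splineKernel m p lam x) (penForm hx p m lam)
    (fun _ _ => rfl) (fun f g => penInner_comm m lam f g) (fun f => penInner_self_nonneg m hlam f)
    (fun f h => Subtype.ext (eq_zero_of_penInner_self_eq_zero f.2 hlam h))
    (fun t => ⟨⟨_, splineKernel_mem hx hp t⟩, rfl⟩)
    fun f t => penInner_splineKernel hx hp hlam f.2 t
  rwa [Submodule.range_subtype] at h

end Kernel

/-! ### The supremum bound -/

section Sup

variable {K : ℕ} {x : Fin (K + 2) → ℝ} {lam : ℝ}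

theorem sum_spacing (hx : IsKnotVector x) : ∑ i, spacing x i = 1 := by
  have : ∀ n : ℕ, ∀ y : Fin (n + 1) → ℝ, ∑ i : Fin n, (y i.succ - y i.castSucc)
      = y (Fin.last n) - y 0 := fun n y => by
    rw [Finset.sum_sub_distrib]
    have h1 := Fin.sum_univ_succ y
    have h2 := Fin.sum_univ_castSucc y
    linarith
  have h := this (K + 1) x
  rw [hx.right, hx.left, sub_zero] at h
  exact h

/-- The reciprocal of a spacing is at most `M * (K + 1)`. -/
theorem inv_spacing_le (hx : IsKnotVector x) {M : ℝ} (hM : 0 < M)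
    (h : (⨆ i, spacing x i) / (⨅ i, spacing x i) ≤ M) (i : Fin (K + 1)) :
    (spacing x i)⁻¹ ≤ M * (K + 1) := by
  have hpos : ∀ i, 0 < spacing x i := fun i => sub_pos.2 (hx.castSucc_lt_succ i)
  have hinf : 0 < ⨅ i, spacing x i := by
    obtain ⟨j, hj⟩ := exists_eq_ciInf_of_finite (f := spacing x)
    exact hj ▸ hpos j
  -- The largest of `K + 1` spacings with sum `1` is at least their mean.
  have hsup : 1 ≤ (K + 1) * ⨆ i, spacing x i := by
    refine (sum_spacing hx).symm.le.trans ?_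
    have := Finset.sum_le_card_nsmul Finset.univ (spacing x) _
      fun i _ => le_ciSup (Set.finite_range (spacing x)).bddAbove i
    simpa using this
  have hle : ⨅ i, spacing x i ≤ spacing x i := ciInf_le (Set.finite_range (spacing x)).bddBelow i
  rw [div_le_iff₀ hinf] at h
  rw [inv_le_iff_one_le_mul₀ (hpos i)]
  calc 1 ≤ (K + 1) * ⨆ i, spacing x i := hsup
    _ ≤ (K + 1) * (M * ⨅ i, spacing x i) := by gcongr
    _ ≤ (K + 1) * (M * spacing x i) := by gcongr
    _ = M * (K + 1) * spacing x i := by ring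

theorem l2Inner_extend_le_penInner (m : ℕ) (hlam : 0 ≤ lam) (f : I → ℝ) :
    l2Inner (extend f) (extend f) ≤ penInner m lam f f :=
  le_add_of_nonneg_right (mul_nonneg hlam (l2Inner_self_nonneg _))

/-- The integral of a square over a subinterval of `[0,1]`. -/
theorem integral_der_sq_le {p : ℕ} (hx : IsKnotVector x) {f : I → ℝ} (hf : f ∈ splineSpace p x)
    (k : ℕ) {a b : ℝ} (ha : 0 ≤ a) (hab : a ≤ b) (hb : b ≤ 1) :
    ∫ t in a..b, der k f t ^ 2 ≤ l2Inner (der k f) (der k f) := by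
  simp only [sq]
  exact intervalIntegral.integral_mono_interval ha hab hb
    (Eventually.of_forall fun _ => mul_self_nonneg _)
    (intervalIntegrable_der_mul_der hx hf hf k (by simp) (by simp))

theorem exists_sq_le_of_spacing (p : ℕ) : ∃ C : ℝ, 0 < C ∧
    ∀ {K : ℕ} {x : Fin (K + 2) → ℝ}, IsKnotVector x → ∀ {M : ℝ}, 0 < M →
      (⨆ i, spacing x i) / (⨅ i, spacing x i) ≤ M → ∀ f ∈ splineSpace p x, ∀ t : I,
        f t ^ 2 ≤ C * (M * (K + 1)) * l2Inner (extend f) (extend f) := by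
  obtain ⟨C, hC, h⟩ := exists_polynomial_sq_le_integral p
  refine ⟨C, hC, fun {K x} hx {M} hM hr f hf t => ?_⟩
  obtain ⟨i, hi⟩ := hx.exists_mem_Icc t.2
  obtain ⟨P, hPd, hP⟩ := exists_polynomial_of_mem hx hf i
  have hlt := hx.castSucc_lt_succ i
  have hend : x i.castSucc + spacing x i = x i.succ := by simp [spacing]
  have h1 := h P hPd (x i.castSucc) (spacing x i) (sub_pos.2 hlt) t (by rwa [hend])
  rw [← hP t hi, extend_coe, hend] at h1
  have h2 : ∫ s in x i.castSucc..x i.succ, P.eval s ^ 2 ≤ l2Inner (extend f) (extend f) := by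
    rw [← der_zero]
    refine le_of_eq_of_le ?_ (integral_der_sq_le hx hf 0 (hx.nonneg _) hlt.le (hx.le_one _))
    refine intervalIntegral.integral_congr fun s hs => ?_
    rw [Set.uIcc_of_le hlt.le] at hs
    simp only [der_zero, hP s hs]
  calc f t ^ 2 ≤ C * ((spacing x i)⁻¹ * ∫ s in x i.castSucc..x i.succ, P.eval s ^ 2) := h1
    _ ≤ C * ((M * (K + 1)) * l2Inner (extend f) (extend f)) := by
        refine mul_le_mul_of_nonneg_left ?_ hC.le
        exact mul_le_mul (inv_spacing_le hx hM hr i) h2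
          (intervalIntegral.integral_nonneg hlt.le fun _ _ => sq_nonneg _) (by positivity)
    _ = _ := by ring

theorem exists_sq_le_of_penalty {m p : ℕ} (hm : 1 ≤ m) (hmp : m < p) : ∃ C : ℝ, 0 < C ∧
    ∀ {K : ℕ} {x : Fin (K + 2) → ℝ}, IsKnotVector x → ∀ f ∈ splineSpace p x, ∀ h : ℝ, 0 < h →
      h ≤ 1 → ∀ t : I, f t ^ 2 ≤ C * (h⁻¹ * penInner m (h ^ (2 * m)) f f) := by
  obtain ⟨r, rfl⟩ := Nat.exists_eq_add_of_le' hm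
  obtain ⟨C, hC, hsob⟩ := exists_sobolev_const r
  refine ⟨C, hC, fun {K x} hx f hf h hh hh1 t => ?_⟩
  -- With this left end, `[a, a + h]` contains `t` and stays inside `[0,1]`, wherever `t` lies.
  set a := (t : ℝ) * (1 - h) with ha
  have ht0 := t.2.1
  have ht1 := t.2.2
  have ha0 : 0 ≤ a := mul_nonneg ht0 (by linarith)
  have hb1 : a + h ≤ 1 := by nlinarith
  have hta : (t : ℝ) ∈ Set.Icc a (a + h) := ⟨by nlinarith, by nlinarith⟩
  have hsub : Set.Icc a (a + h) ⊆ Set.Icc (0 : ℝ) 1 := Set.Icc_subset_Icc ha0 hb1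
  have haI : a ∈ Set.Icc (0 : ℝ) 1 := hsub ⟨le_rfl, by linarith⟩
  have hbI : a + h ∈ Set.Icc (0 : ℝ) 1 := hsub ⟨by linarith, le_rfl⟩
  have h1 := hsob (fun k => der k f) a h hh
    (by simpa only [der_zero] using (continuousOn_extend hf).mono hsub)
    (fun k _ => (piecewisePolynomial_der hx hf (k + 1)).intervalIntegrable hx haI hbI)
    (fun k hk s hs => integral_der hx hf (by omega) haI (hsub hs))
    (by simpa only [sq] using intervalIntegrable_der_mul_der hx hf hf (r + 1) haI hbI) t hta
  have h0 := integral_der_sq_le hx hf 0 ha0 (by linarith) hb1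
  have h2 := integral_der_sq_le hx hf (r + 1) ha0 (by linarith) hb1
  simp only [der_zero, extend_coe] at h0 h1
  refine h1.trans ?_
  unfold penInner
  gcongr

theorem abs_le_mul_sqrt {c r y z : ℝ} (hc : 0 ≤ c) (hr : 0 ≤ r) (h : z ^ 2 ≤ c * r ^ 2 * y) :
    |z| ≤ √c * r * √y := by
  refine (Real.abs_le_sqrt h).trans_eq ?_
  rw [Real.sqrt_mul (by positivity), Real.sqrt_mul hc, Real.sqrt_sq hr]

theorem exists_abs_le_supRate {m p : ℕ} (hm : 1 ≤ m) (hmp : m < p) {M : ℝ} (hM : 0 < M) :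
    ∃ c₀ : ℝ, 0 < c₀ ∧ ∀ {K : ℕ} {x : Fin (K + 2) → ℝ}, IsKnotVector x → 1 ≤ K →
      (⨆ i, spacing x i) / (⨅ i, spacing x i) ≤ M → ∀ lam ∈ Set.Icc (0 : ℝ) 1,
        ∀ f ∈ splineSpace p x, ∀ t : I, |f t| ≤ c₀ * supRate m K lam * penNorm m lam f := by
  obtain ⟨C₁, hC₁, h₁⟩ := exists_sq_le_of_spacing p
  obtain ⟨C₂, hC₂, h₂⟩ := exists_sq_le_of_penalty hm hmp
  -- The factor `2` absorbs `K + 1 ≤ 2 K`.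
  set c := max (C₁ * (2 * M)) C₂ with hc
  have hcpos : 0 < c := lt_max_of_lt_right hC₂
  refine ⟨√c, Real.sqrt_pos.2 hcpos, fun {K x} hx hK hr lam hlam f hf t => ?_⟩
  have hpen := penInner_self_nonneg m hlam.1 f
  have hKr : (1 : ℝ) ≤ K := by exact_mod_cast hK
  have hfirst : |f t| ≤ √c * (K : ℝ) ^ (1 / 2 : ℝ) * penNorm m lam f := by
    refine abs_le_mul_sqrt hcpos.le (by positivity) ?_
    rw [← Real.sqrt_eq_rpow, Real.sq_sqrt (by positivity)]
    calc f t ^ 2 ≤ C₁ * (M * (K + 1)) * l2Inner (extend f) (extend f) := h₁ hx hM hr f hf t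
      _ ≤ C₁ * (M * (K + K)) * penInner m lam f f := by
          gcongr
          · exact l2Inner_self_nonneg _
          · exact l2Inner_extend_le_penInner m hlam.1 f
      _ = C₁ * (2 * M) * K * penInner m lam f f := by ring
      _ ≤ c * K * penInner m lam f f := by
          gcongr
          exact le_max_left _ _
  unfold supRate
  split_ifs with h0
  · exact hfirst
  have hpos : 0 < lam := lt_of_le_of_ne hlam.1 (Ne.symm h0)
  have hm0 : (m : ℝ) ≠ 0 := by exact_mod_cast (by omega : m ≠ 0)
  rcases min_choice ((K : ℝ) ^ (1 / 2 : ℝ)) (lam ^ (-(1 / (4 * (m : ℝ))))) with hmin | hmin <;>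
    rw [hmin]
  · exact hfirst
  · refine abs_le_mul_sqrt hcpos.le (by positivity) ?_
    -- The window length `h = lam^(1/(2m))` turns the weight `h^(2m)` into `lam`, and `h⁻¹` is the
    -- square of the claimed rate; `lam ≤ 1` ensures `h ≤ 1`.
    have hpow : (lam ^ (1 / (2 * (m : ℝ)))) ^ (2 * m) = lam := by
      rw [← Real.rpow_natCast, ← Real.rpow_mul hpos.le]
      push_cast
      rw [one_div_mul_cancel (by positivity), Real.rpow_one]
    have hinv : (lam ^ (1 / (2 * (m : ℝ))))⁻¹ = (lam ^ (-(1 / (4 * (m : ℝ))))) ^ 2 := by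
      rw [← Real.rpow_neg hpos.le, ← Real.rpow_natCast, ← Real.rpow_mul hpos.le]
      congr 1
      push_cast
      field_simp
      norm_num
    have h := h₂ hx f hf (lam ^ (1 / (2 * (m : ℝ)))) (by positivity)
      (Real.rpow_le_one hpos.le hlam.2 (by positivity)) t
    rw [hpow, hinv] at h
    calc f t ^ 2 ≤ C₂ * ((lam ^ (-(1 / (4 * (m : ℝ))))) ^ 2 * penInner m lam f f) := h
      _ ≤ c * ((lam ^ (-(1 / (4 * (m : ℝ))))) ^ 2 * penInner m lam f f) := by
          gcongr
          exact le_max_right _ _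
      _ = _ := by ring

end Sup

end PenalizedSpline

theorem proposition1 (m p : ℕ) (hm : 1 ≤ m) (hmp : m < p) (M : ℝ) (hM : 0 < M) :
    ∃ c₀ : ℝ, 0 < c₀ ∧
      ∀ (K : ℕ → ℕ) (x : ∀ n, Fin (K n + 2) → ℝ),
        (∀ n, IsKnotVector (x n)) → KnotGrowth K → QuasiUniformKnots K x M →
        ∀ n, 1 ≤ K n → ∀ lam ∈ Set.Icc (0 : ℝ) 1,
          (∀ f ∈ splineSpace p (x n), ∀ t : unitInterval,
            |f t| ≤ c₀ * supRate m (K n) lam * penNorm m lam f) ∧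
          IsUnit (penGram m p lam (x n)).det ∧
          (∀ s t, splineKernel m p lam (x n) s t = splineKernel m p lam (x n) t s) ∧
          (∀ t, (fun s => splineKernel m p lam (x n) s t) ∈ splineSpace p (x n)) ∧
          (∀ f ∈ splineSpace p (x n), ∀ t : unitInterval,
            f t = penInner m lam (fun s => splineKernel m p lam (x n) t s) f) ∧
          IsRKHSWithKernel (splineSpace p (x n)) (penInner m lam)
            (splineKernel m p lam (x n)) := by
  obtain ⟨c₀, hc₀, hsup⟩ := exists_abs_le_supRate hm hmp hM
  refine ⟨c₀, hc₀, fun K x hx _ hq n hK lam hlam => ?_⟩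
  have hp : 2 ≤ p := by omega
  refine ⟨hsup (hx n) hK (hq.2 n) lam hlam, isUnit_det_penGram (hx n) hp hlam.1,
    splineKernel_comm, splineKernel_mem (hx n) hp, fun f hf t => ?_,
    isRKHSWithKernel_splineSpace (hx n) hp hlam.1⟩
  simp only [splineKernel_comm t]
  exact penInner_splineKernel (hx n) hp hlam.1 hf t
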